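/- Theorem. Consider instances consisting of a finite set of $n$ independent tasks to be scheduled without preemption on $m$ identical CPUs and $k$ identical GPUs, where $1\le k\le m$; task $j$ takes time $\overline{p_j}>0$ on a CPU and $\underline{p_j}>0$ on a GPU. Let $C^*_{\max}$ be the minimum makespan over all feasible schedules. HeteroPrio is the following algorithm. Sort the tasks into a list $L$ by non-decreasing acceleration factor $\alpha_j=\overline{p_j}/\underline{p_j}$. Repeatedly consider a resource $i$ that is idle first, say at time $t$. If $L$ is non-empty, remove its first task (if $i$ is a CPU) or its last task (if $i$ is a GPU) and start it on $i$ at time $t$. If $L$ is empty, let $S$ be the set of the tasks assigned to other resources that would finish strictly earlier if they were started from scratch on $i$ at time $t$. If $S\neq\emptyset$, take a task of $S$ with the highest current finish time, abort it on its resource (which becomes idle at time $t$) and start it from scratch on $i$ at time $t$ (spoliation). If $S=\emptyset$, leave $i$ idle from then on. The algorithm stops when every resource has been left idle in this way. All ties (in the sorting, in the choice of the idle resource, and in the choice of the task of $S$) are broken arbitrarily, and every schedule that can result is an output of HeteroPrio. The approximation ratio of HeteroPrio is the supremum of (makespan of the output)$/C^*_{\max}$ over all instances with at least one task and all outputs.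 Then HeteroPrio has an output on every instance and all its outputs are feasible schedules. Its approximation ratio is at least $2+\frac{2}{\sqrt3}\approx 3.15$ and at most $2+\sqrt2\approx 3.41$. Moreover, on every instance in which $\overline{p_j}\le C^*_{\max}$ and $\underline{p_j}\le C^*_{\max}$ for every task $j$, every output of HeteroPrio has makespan at most $2\,C^*_{\max}$. -/

import Mathlib

namespace HybridScheduling

/-- An instance of the problem `(Pm, Pk) || Cmax`: `n` independent tasks to be scheduled on `m`
identical CPUs and `k` identical GPUs, where `1 ≤ k ≤ m`. -/
structure Instance where
  n : ℕ
  m : ℕ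
  k : ℕ
  one_le_k : 1 ≤ k
  k_le_m : k ≤ m
  cpuTime : Fin n → ℝ
  gpuTime : Fin n → ℝ
  cpuTime_pos : ∀ j, 0 < cpuTime j
  gpuTime_pos : ∀ j, 0 < gpuTime j

namespace Instance

abbrev Task (I : Instance) : Type := Fin I.n

/-- The resources: `Sum.inl c` is a CPU and `Sum.inr g` is a GPU. -/
abbrev Resource (I : Instance) : Type := Fin I.m ⊕ Fin I.k

/-- Processing time of a task on a resource. -/
def time (I : Instance) (j : I.Task) : I.Resource → ℝ
  | Sum.inl _ => I.cpuTime j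
  | Sum.inr _ => I.gpuTime j

/-- The acceleration factor of a task. -/
noncomputable def accel (I : Instance) (j : I.Task) : ℝ := I.cpuTime j / I.gpuTime j

end Instance

/-- A (non-preemptive) schedule: a resource and a starting time for every task. -/
structure Schedule (I : Instance) where
  proc : I.Task → I.Resource
  start : I.Task → ℝ

namespace Schedule

variable {I : Instance}

/-- Completion time of a task. -/
def completion (S : Schedule I) (j : I.Task) : ℝ := S.start j + I.time j (S.proc j)

/-- No task starts before time `0`, and no resource processes two tasks at the same time. -/
def Feasible (S : Schedule I) : Prop :=
  (∀ j, 0 ≤ S.start j) ∧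
    ∀ i j, i ≠ j → S.proc i = S.proc j →
      S.completion i ≤ S.start j ∨ S.completion j ≤ S.start i

/-- The largest completion time (`0` if there is no task). -/
noncomputable def makespan (S : Schedule I) : ℝ := ⨆ j, S.completion j

end Schedule

/-- The optimal makespan. -/
noncomputable def Instance.optMakespan (I : Instance) : ℝ :=
  sInf {C : ℝ | ∃ S : Schedule I, S.Feasible ∧ S.makespan = C}

/-- A scheduling algorithm whose ties are left open: `alg I S` says that `S` is a possible output
of the algorithm on `I`. -/
abbrev Algorithm : Type := ∀ I : Instance, Schedule I → Prop

/-- The approximation ratio: the supremum, over all instances and all possible outputs, of the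
makespan of the output divided by the optimal makespan. -/
noncomputable def approximationRatio (alg : Algorithm) : EReal :=
  ⨆ (I : Instance) (S : Schedule I) (_ : alg I S), ((S.makespan / I.optMakespan : ℝ) : EReal)

namespace HeteroPrio

/-- A state of the algorithm.
* `queue` : the list `L` of the tasks that have not been started;
* `place j` : the resource to which task `j` is currently assigned and its starting time there;
* `avail r` : the time from which resource `r` is idle, given the current assignments;
* `resting` : the resources that were found idle with nothing to start and nothing to spoliate. -/
structure State (I : Instance) where
  queue : List I.Task
  place : I.Task → Option (I.Resource × ℝ)
  avail : I.Resource → ℝ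
  resting : Finset I.Resource

variable {I : Instance}

/-- The state before the first iteration, for a given list of tasks. -/
def initial (L : List I.Task) : State I where
  queue := L
  place := fun _ => none
  avail := fun _ => 0
  resting := ∅

/-- `L` lists every task exactly once, by non-decreasing acceleration factor. -/
def IsSortedTaskList (L : List I.Task) : Prop :=
  L.Nodup ∧ (∀ j, j ∈ L) ∧ L.Pairwise (fun i j => I.accel i ≤ I.accel j)

/-- `r` is a first idle resource, its idle time being `σ.avail r`. -/
def FirstIdle (σ : State I) (r : I.Resource) : Prop :=
  r ∉ σ.resting ∧ ∀ r', r' ∉ σ.resting → σ.avail r ≤ σ.avail r'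

/-- Task `j`, assigned to the other resource `r'` since time `s`, would finish earlier if it were
started on `r` at the time at which `r` is idle. -/
def Candidate (σ : State I) (r : I.Resource) (j : I.Task) (r' : I.Resource) (s : ℝ) : Prop :=
  σ.place j = some (r', s) ∧ r' ≠ r ∧ σ.avail r + I.time j r < s + I.time j r'

/-- One iteration of the algorithm. -/
inductive Step : State I → State I → Prop
  /-- An idle CPU starts the head of the list. -/
  | startCPU (σ : State I) (c : Fin I.m) (j : I.Task) (L : List I.Task)
      (hidle : FirstIdle σ (Sum.inl c)) (hL : σ.queue = j :: L) :
      Step σ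
        { queue := L
          place := Function.update σ.place j (some (Sum.inl c, σ.avail (Sum.inl c)))
          avail := Function.update σ.avail (Sum.inl c) (σ.avail (Sum.inl c) + I.cpuTime j)
          resting := σ.resting }
  /-- An idle GPU starts the tail of the list. -/
  | startGPU (σ : State I) (g : Fin I.k) (j : I.Task) (L : List I.Task)
      (hidle : FirstIdle σ (Sum.inr g)) (hL : σ.queue = L ++ [j]) :
      Step σ
        { queue := L
          place := Function.update σ.place j (some (Sum.inr g, σ.avail (Sum.inr g)))
          avail := Function.update σ.avail (Sum.inr g) (σ.avail (Sum.inr g) + I.gpuTime j)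
          resting := σ.resting }
  /-- The list is empty: an idle resource `r` takes over, from scratch, a candidate `j` with the
  highest finish time; the resource `r'` that was processing `j` becomes idle at that moment. -/
  | spoliate (σ : State I) (r : I.Resource) (j : I.Task) (r' : I.Resource) (s : ℝ)
      (hidle : FirstIdle σ r) (hL : σ.queue = []) (hj : Candidate σ r j r' s)
      (hmax : ∀ i q u, Candidate σ r i q u → u + I.time i q ≤ s + I.time j r') :
      Step σ
        { queue := []
          place := Function.update σ.place j (some (r, σ.avail r))
          avail := Function.update (Function.update σ.avail r' (σ.avail r)) r
            (σ.avail r + I.time j r)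
          resting := σ.resting }
  /-- The list is empty and there is no candidate: the idle resource `r` stays idle. It need not be
  looked at again, since it cannot get a candidate later. -/
  | rest (σ : State I) (r : I.Resource)
      (hidle : FirstIdle σ r) (hL : σ.queue = [])
      (hnone : ∀ j r' s, ¬ Candidate σ r j r' s) :
      Step σ
        { queue := []
          place := σ.place
          avail := σ.avail
          resting := insert r σ.resting }

/-- `S` is a possible output of HeteroPrio: some run, from some sorted list of the tasks, reaches a
state in which no resource has anything left to do and whose assignments are those of `S`. -/
def Output : Algorithm := fun I S =>
  ∃ (L : List I.Task) (σ : State I), IsSortedTaskList L ∧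
    Relation.ReflTransGen Step (initial L) σ ∧ (∀ r, r ∈ σ.resting) ∧
    ∀ j, σ.place j = some (S.proc j, S.start j)

end HeteroPrio

end HybridScheduling

/-!
The list `L` is sorted by acceleration factor, CPUs take its head and GPUs its tail. Hence, when
`L` becomes empty, a prefix of `L` is on the CPUs and a suffix on the GPUs (`ListPhase`), and no
resource has been idle up to the time `T` at which the first one becomes idle. With a suitable
price of GPU time against CPU time every task is at its cheapest place, so that no schedule is
shorter than `T` (`ListPhase.le_of_load_le`). All tasks are started by time `T ≤ C`, where `C` is
the optimal makespan, and spoliations only decrease completion times. If no task takes longer than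
`C`, this gives the bound `2 * C`.

In general, suppose that a task `j` completes after `(2 + √2) * C`, and that the list phase put it
on a CPU (CPUs and GPUs play the same role here). Its CPU time is above `(1 + √2) * C`, so an
optimal schedule has it on a GPU, its GPU time is at most `C`, and its acceleration factor is
above `1 + √2`, as is that of every task that the list phase put on a GPU. As long as `j` remains
late, every spoliated task completes late on a CPU, so that its CPU time is above `C`, and an
optimal schedule has it on a GPU, too; in particular nothing moves from a GPU to a CPU. As `j` is
not a candidate on a GPU that is left idle, the GPUs are all busy until `C` before the completion
of `j`. From `T` on, a GPU works on its last task of the list phase, which either is on a GPU in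
the optimal schedule or takes at most `(√2 - 1) * C`, and on spoliated tasks. The tasks that the
optimal schedule has on GPUs amount to at most `C` per GPU on average. So `j` completes by `T +
(√2 - 1) * C + C + C`, which is at most `(2 + √2) * C` (`LateTask`, `finish_le_of_load_le`).

For the lower bound, `BadInstance.inst` keeps the resources busy until almost time `1` with tasks
that an optimal schedule puts on CPUs. Then the CPUs start tasks that only fit on GPUs, and the
GPUs take these over in an order for which list scheduling has a ratio close to `2`. With
acceleration factors up to `ρ = 3 + 2 * √3`, the last of these tasks remains on its CPU, and
completes close to `1 + ρ / 3 = 2 + 2 / √3`, while the optimal makespan is at most `1`. That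
HeteroPrio can produce these schedules follows from general lemmas on runs that follow a timetable
(`exists_listPhase_run`, `exists_spoliation_run`).
-/

namespace HybridScheduling

theorem Instance.time_pos (I : Instance) (j : I.Task) (r : I.Resource) : 0 < I.time j r := by
  cases r with
  | inl c => exact I.cpuTime_pos j
  | inr g => exact I.gpuTime_pos j

namespace HeteroPrio

variable {I : Instance}

/-! ### Steps, the clock and feasibility -/

/-- The state in which the idle resource `r` has just started task `j`, with `Q` still waiting. -/
def State.begin (σ : State I) (r : I.Resource) (j : I.Task) (Q : List I.Task) : State I where
  queue := Q
  place := Function.update σ.place j (some (r, σ.avail r))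
  avail := Function.update σ.avail r (σ.avail r + I.time j r)
  resting := σ.resting

/-- The state in which the idle resource `r` has just taken task `j` over from `r'`. -/
def State.takeOver (σ : State I) (r : I.Resource) (j : I.Task) (r' : I.Resource) : State I where
  queue := []
  place := Function.update σ.place j (some (r, σ.avail r))
  avail := Function.update (Function.update σ.avail r' (σ.avail r)) r (σ.avail r + I.time j r)
  resting := σ.resting

/-- The state in which the resource `r` has just been left idle. -/
def State.retire (σ : State I) (r : I.Resource) : State I where
  queue := []
  place := σ.place
  avail := σ.avail
  resting := insert r σ.resting

/-- `j` is the task that a resource like `r` takes from the list `Q`, leaving the list `Q'`. -/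
def Pops (Q : List I.Task) (r : I.Resource) (j : I.Task) (Q' : List I.Task) : Prop :=
  (r.isLeft = true ∧ Q = j :: Q') ∨ (r.isLeft = false ∧ Q = Q' ++ [j])

theorem Pops.perm {Q Q' : List I.Task} {r : I.Resource} {j : I.Task} (h : Pops Q r j Q') :
    Q.Perm (j :: Q') := by
  rcases h with ⟨-, rfl⟩ | ⟨-, rfl⟩
  · exact List.Perm.refl _
  · exact List.perm_append_singleton _ _

theorem Step.begin {σ : State I} {r : I.Resource} {j : I.Task} {Q : List I.Task}
    (hidle : FirstIdle σ r) (hQ : Pops σ.queue r j Q) : Step σ (σ.begin r j Q) := by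
  rcases hQ with ⟨hr, hQ⟩ | ⟨hr, hQ⟩ <;> rcases r with c | g <;> simp at hr
  · exact Step.startCPU σ c j Q hidle hQ
  · exact Step.startGPU σ g j Q hidle hQ

/-- The two ways of starting a task are treated as one. -/
theorem Step.cases_begin {σ σ' : State I} (h : Step σ σ') :
    (∃ r j Q, FirstIdle σ r ∧ Pops σ.queue r j Q ∧ σ' = σ.begin r j Q) ∨
    (∃ r j r' s, FirstIdle σ r ∧ σ.queue = [] ∧ Candidate σ r j r' s ∧
      (∀ i q u, Candidate σ r i q u → u + I.time i q ≤ s + I.time j r') ∧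
      σ' = σ.takeOver r j r') ∨
    (∃ r, FirstIdle σ r ∧ σ.queue = [] ∧ (∀ j r' s, ¬ Candidate σ r j r' s) ∧
      σ' = σ.retire r) := by
  cases h with
  | startCPU c j L hidle hL => exact Or.inl ⟨_, j, L, hidle, Or.inl ⟨rfl, hL⟩, rfl⟩
  | startGPU g j L hidle hL => exact Or.inl ⟨_, j, L, hidle, Or.inr ⟨rfl, hL⟩, rfl⟩
  | spoliate r j r' s hidle hL hj hmax =>
    exact Or.inr (Or.inl ⟨r, j, r', s, hidle, hL, hj, hmax, rfl⟩)
  | rest r hidle hL hnone => exact Or.inr (Or.inr ⟨r, hidle, hL, hnone, rfl⟩)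

/-- The invariant of the algorithm. The idle times of the resources that are not resting act as a
clock: no task has been started after any of them. -/
structure Consistent (σ : State I) : Prop where
  queue_nodup : σ.queue.Nodup
  mem_queue : ∀ j, j ∈ σ.queue ↔ σ.place j = none
  queue_eq_nil : ∀ r ∈ σ.resting, σ.queue = []
  avail_nonneg : ∀ r, 0 ≤ σ.avail r
  start_nonneg : ∀ j r s, σ.place j = some (r, s) → 0 ≤ s
  start_le : ∀ j r s, σ.place j = some (r, s) → ∀ r', r' ∉ σ.resting → s ≤ σ.avail r'
  completion_le : ∀ j r s, σ.place j = some (r, s) → s + I.time j r ≤ σ.avail r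
  disjoint : ∀ i j r s u, i ≠ j → σ.place i = some (r, s) → σ.place j = some (r, u) →
    s + I.time i r ≤ u ∨ u + I.time j r ≤ s

theorem consistent_initial {L : List I.Task} (hL : IsSortedTaskList L) :
    Consistent (initial L) where
  queue_nodup := hL.1
  mem_queue j := by simp [initial, hL.2.1 j]
  queue_eq_nil r hr := by simp [initial] at hr
  avail_nonneg r := le_rfl
  start_nonneg j r s h := by simp [initial] at h
  start_le j r s h := by simp [initial] at h
  completion_le j r s h := by simp [initial] at h
  disjoint i j r s u _ h := by simp [initial] at h

theorem Candidate.time_lt {σ : State I} (hσ : Consistent σ) {r r' : I.Resource} {j : I.Task}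
    {s : ℝ} (hr : r ∉ σ.resting) (h : Candidate σ r j r' s) : I.time j r < I.time j r' := by
  have := hσ.start_le _ _ _ h.1 r hr
  linarith [h.2.2]

theorem Consistent.begin {σ : State I} (hσ : Consistent σ) {r : I.Resource} {j : I.Task}
    {Q : List I.Task} (hidle : FirstIdle σ r) (hQ : Pops σ.queue r j Q) :
    Consistent (σ.begin r j Q) := by
  have hp := hQ.perm
  have hnd := hp.nodup_iff.1 hσ.queue_nodup
  have hpos := I.time_pos j r
  refine ⟨hnd.of_cons, fun i => ?_, fun q hq => ?_, fun q => ?_, fun i q s h => ?_,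
    fun i q s h q' hq' => ?_, fun i q s h => ?_, fun i i' q s u hii' h h' => ?_⟩
  · simp only [State.begin, Function.update_apply]
    split_ifs with hij
    · subst hij
      simpa using (List.nodup_cons.1 hnd).1
    · rw [← hσ.mem_queue, hp.mem_iff]
      simp [hij]
  · have := hσ.queue_eq_nil q hq
    rw [this] at hp
    simp at hp
  · simp only [State.begin, Function.update_apply]
    split_ifs
    · linarith [hσ.avail_nonneg r]
    · exact hσ.avail_nonneg q
  · simp only [State.begin, Function.update_apply] at h
    split_ifs at h with hij
    · simp only [Option.some.injEq, Prod.mk.injEq] at h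
      rw [← h.2]
      exact hσ.avail_nonneg r
    · exact hσ.start_nonneg _ _ _ h
  · have h1 : s ≤ σ.avail r := by
      simp only [State.begin, Function.update_apply] at h
      split_ifs at h with hij
      · simp only [Option.some.injEq, Prod.mk.injEq] at h
        exact h.2.ge
      · exact hσ.start_le _ _ _ h r hidle.1
    simp only [State.begin, Function.update_apply]
    split_ifs
    · linarith
    · exact h1.trans (hidle.2 q' hq')
  · simp only [State.begin, Function.update_apply] at h ⊢
    split_ifs at h with hij
    · simp only [Option.some.injEq, Prod.mk.injEq] at h
      obtain ⟨rfl, rfl⟩ := h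
      simp [hij]
    · have := hσ.completion_le _ _ _ h
      split_ifs with hq
      · subst hq; linarith
      · exact this
  · simp only [State.begin, Function.update_apply] at h h'
    split_ifs at h with hij
    · rw [if_neg (fun h => hii' (hij.trans h.symm))] at h'
      simp only [Option.some.injEq, Prod.mk.injEq] at h
      obtain ⟨rfl, rfl⟩ := h
      exact Or.inr (hσ.completion_le _ _ _ h')
    · split_ifs at h' with hij'
      · simp only [Option.some.injEq, Prod.mk.injEq] at h'
        obtain ⟨rfl, rfl⟩ := h'
        exact Or.inl (hσ.completion_le _ _ _ h)
      · exact hσ.disjoint _ _ _ _ _ hii' h h'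

theorem Consistent.takeOver {σ : State I} (hσ : Consistent σ) {r r' : I.Resource} {j : I.Task}
    {s : ℝ} (hidle : FirstIdle σ r) (hQ : σ.queue = []) (hj : Candidate σ r j r' s) :
    Consistent (σ.takeOver r j r') := by
  have hpos := I.time_pos j r
  have hs := hσ.start_le _ _ _ hj.1 r hidle.1
  -- the aborted task is the last one on its resource
  have hlast : ∀ i u, i ≠ j → σ.place i = some (r', u) → u + I.time i r' ≤ σ.avail r := by
    intro i u hij hi
    have h1 := hσ.start_le _ _ _ hi r hidle.1
    rcases hσ.disjoint _ _ _ _ _ hij hi hj.1 with h | h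
    · linarith
    · linarith [hj.2.2]
  refine ⟨List.nodup_nil, fun i => ?_, fun q hq => rfl, fun q => ?_, fun i q u h => ?_,
    fun i q u h q' hq' => ?_, fun i q u h => ?_, fun i i' q u v hii' h h' => ?_⟩
  · simp only [State.takeOver, Function.update_apply]
    split_ifs with hij
    · simp
    · rw [← hσ.mem_queue, hQ]
  · simp only [State.takeOver, Function.update_apply]
    split_ifs
    · linarith [hσ.avail_nonneg r]
    · exact hσ.avail_nonneg r
    · exact hσ.avail_nonneg q
  · simp only [State.takeOver, Function.update_apply] at h
    split_ifs at h with hij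
    · simp only [Option.some.injEq, Prod.mk.injEq] at h
      rw [← h.2]
      exact hσ.avail_nonneg r
    · exact hσ.start_nonneg _ _ _ h
  · have h1 : u ≤ σ.avail r := by
      simp only [State.takeOver, Function.update_apply] at h
      split_ifs at h with hij
      · simp only [Option.some.injEq, Prod.mk.injEq] at h
        exact h.2.ge
      · exact hσ.start_le _ _ _ h r hidle.1
    simp only [State.takeOver, Function.update_apply]
    split_ifs
    · linarith
    · exact h1
    · exact h1.trans (hidle.2 q' hq')
  · simp only [State.takeOver, Function.update_apply] at h ⊢
    split_ifs at h with hij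
    · simp only [Option.some.injEq, Prod.mk.injEq] at h
      obtain ⟨rfl, rfl⟩ := h
      simp [hij]
    · have := hσ.completion_le _ _ _ h
      split_ifs with hq hq'
      · subst hq; linarith
      · subst hq'; exact hlast i u hij h
      · exact this
  · simp only [State.takeOver, Function.update_apply] at h h'
    split_ifs at h with hij
    · rw [if_neg (fun h => hii' (hij.trans h.symm))] at h'
      simp only [Option.some.injEq, Prod.mk.injEq] at h
      obtain ⟨rfl, rfl⟩ := h
      exact Or.inr (hσ.completion_le _ _ _ h')
    · split_ifs at h' with hij'
      · simp only [Option.some.injEq, Prod.mk.injEq] at h'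
        obtain ⟨rfl, rfl⟩ := h'
        exact Or.inl (hσ.completion_le _ _ _ h)
      · exact hσ.disjoint _ _ _ _ _ hii' h h'

theorem Consistent.retire {σ : State I} (hσ : Consistent σ) (hQ : σ.queue = [])
    (r : I.Resource) : Consistent (σ.retire r) where
  queue_nodup := List.nodup_nil
  mem_queue j := by
    have := hσ.mem_queue j
    rw [hQ] at this
    exact this
  queue_eq_nil _ _ := rfl
  avail_nonneg := hσ.avail_nonneg
  start_nonneg := hσ.start_nonneg
  start_le j q s h q' hq' := hσ.start_le j q s h q' fun h' => hq' (Finset.mem_insert_of_mem h')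
  completion_le := hσ.completion_le
  disjoint := hσ.disjoint

theorem Consistent.step {σ σ' : State I} (hσ : Consistent σ) (h : Step σ σ') :
    Consistent σ' := by
  rcases h.cases_begin with ⟨r, j, Q, hidle, hQ, rfl⟩ | ⟨r, j, r', s, hidle, hQ, hj, -, rfl⟩ |
    ⟨r, hidle, hQ, -, rfl⟩
  · exact hσ.begin hidle hQ
  · exact hσ.takeOver hidle hQ hj
  · exact hσ.retire hQ r

theorem Consistent.steps {σ σ' : State I} (hσ : Consistent σ)
    (h : Relation.ReflTransGen Step σ σ') : Consistent σ' := by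
  induction h with
  | refl => exact hσ
  | tail _ h ih => exact ih.step h

theorem Output.feasible {S : Schedule I} (hS : Output I S) : S.Feasible := by
  obtain ⟨L, σ, hL, hrun, -, hplace⟩ := hS
  have hσ := (consistent_initial hL).steps hrun
  refine ⟨fun j => hσ.start_nonneg _ _ _ (hplace j), fun i j hij hp => ?_⟩
  have hj := hplace j
  rw [← hp] at hj
  have := hσ.disjoint i j _ _ _ hij (hplace i) hj
  simpa only [Schedule.completion, ← hp] using this

/-! ### Termination -/

/-- Some resource other than the one processing `j` would process it faster. -/
def Slow (σ : State I) (j : I.Task) : Prop :=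
  ∃ r s r', σ.place j = some (r, s) ∧ I.time j r' < I.time j r

open Classical in
/-- Starting a task removes it from the list and makes at most one more task slow; a spoliation
moves a slow task to a resource on which it is not slow. -/
noncomputable def potential (σ : State I) : ℕ :=
  2 * σ.queue.length + (Finset.univ.filter (Slow σ)).card + σ.restingᶜ.card

theorem exists_firstIdle {σ : State I} (h : ∃ r, r ∉ σ.resting) : ∃ r, FirstIdle σ r := by
  obtain ⟨r, hr, hmin⟩ := σ.restingᶜ.exists_min_image σ.avail
    (h.imp fun r hr => Finset.mem_compl.2 hr)
  exact ⟨r, Finset.mem_compl.1 hr, fun r' hr' => hmin r' (Finset.mem_compl.2 hr')⟩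

theorem exists_best_candidate {σ : State I} {r : I.Resource}
    (h : ∃ j r' s, Candidate σ r j r' s) :
    ∃ j r' s, Candidate σ r j r' s ∧
      ∀ i q u, Candidate σ r i q u → u + I.time i q ≤ s + I.time j r' := by
  classical
  let f : I.Task → ℝ := fun j => (σ.place j).elim 0 fun x => x.2 + I.time j x.1
  obtain ⟨j, hj, hmax⟩ := Finset.exists_max_image
    (Finset.univ.filter fun j => ∃ r' s, Candidate σ r j r' s) f
    (by obtain ⟨j, hj⟩ := h; exact ⟨j, by simpa using hj⟩)
  obtain ⟨r', s, hc⟩ := (Finset.mem_filter.1 hj).2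
  refine ⟨j, r', s, hc, fun i q u hi => ?_⟩
  have := hmax i (Finset.mem_filter.2 ⟨Finset.mem_univ _, q, u, hi⟩)
  simpa [f, hc.1, hi.1] using this

theorem exists_step_potential_lt {σ : State I} (hσ : Consistent σ) (h : ∃ r, r ∉ σ.resting) :
    ∃ σ', Step σ σ' ∧ potential σ' < potential σ := by
  classical
  obtain ⟨r, hr⟩ := exists_firstIdle h
  by_cases hQ : σ.queue = []
  · by_cases hc : ∃ j r' s, Candidate σ r j r' s
    · obtain ⟨j, r', s, hj, hmax⟩ := exists_best_candidate hc
      refine ⟨σ.takeOver r j r', Step.spoliate σ r j r' s hr hQ hj hmax, ?_⟩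
      have hlt := hj.time_lt hσ hr.1
      have hsub : Finset.univ.filter (Slow (σ.takeOver r j r')) ⊂ Finset.univ.filter (Slow σ) := by
        refine Finset.ssubset_iff_of_subset (fun i hi => ?_) |>.2
          ⟨j, by simpa using ⟨r', s, r, hj.1, hlt⟩, ?_⟩
        · simp only [Finset.mem_filter, Finset.mem_univ, true_and] at hi ⊢
          obtain ⟨q, u, q', hi, hlt'⟩ := hi
          simp only [State.takeOver, Function.update_apply] at hi
          split_ifs at hi with hij
          · subst hij
            exact ⟨r', s, r, hj.1, hlt⟩
          · exact ⟨q, u, q', hi, hlt'⟩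
        · simp only [Finset.mem_filter, Finset.mem_univ, true_and]
          rintro ⟨q, u, q', hi, hlt'⟩
          simp only [State.takeOver, Function.update_self, Option.some.injEq,
            Prod.mk.injEq] at hi
          obtain ⟨rfl, -⟩ := hi
          -- with only two processing times, the smaller one is not slow
          rcases r with c | g <;> rcases r' with c' | g' <;> rcases q' with c'' | g'' <;>
            simp only [Instance.time] at hlt hlt' <;> linarith
      have := Finset.card_lt_card hsub
      simp only [potential, State.takeOver, hQ] at this ⊢
      omega
    · refine ⟨σ.retire r, Step.rest σ r hr hQ (by push Not at hc; exact hc), ?_⟩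
      have hsub : (σ.retire r).restingᶜ ⊂ σ.restingᶜ :=
        Finset.compl_ssubset_compl.2 (Finset.ssubset_insert hr.1)
      have hlt := Finset.card_lt_card hsub
      have h3 : (σ.retire r).queue = σ.queue := hQ.symm
      have h4 : Slow (σ.retire r) = Slow σ := rfl
      rw [potential, potential, h3, h4]
      omega
  · obtain ⟨j, Q, hj⟩ : ∃ j Q, Pops σ.queue r j Q := by
      rcases r with c | g
      · obtain ⟨j, Q, h⟩ := List.exists_cons_of_ne_nil hQ
        exact ⟨j, Q, Or.inl ⟨rfl, h⟩⟩
      · exact ⟨σ.queue.getLast hQ, σ.queue.dropLast,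
          Or.inr ⟨rfl, (List.dropLast_append_getLast hQ).symm⟩⟩
    refine ⟨σ.begin r j Q, Step.begin hr hj, ?_⟩
    have hsub : Finset.univ.filter (Slow (σ.begin r j Q)) ⊆
        insert j (Finset.univ.filter (Slow σ)) := by
      intro i hi
      simp only [Finset.mem_filter, Finset.mem_univ, true_and, Finset.mem_insert] at hi ⊢
      obtain ⟨q, u, q', hi, hlt'⟩ := hi
      simp only [State.begin, Function.update_apply] at hi
      split_ifs at hi with hij
      · exact Or.inl hij
      · exact Or.inr ⟨q, u, q', hi, hlt'⟩
    have h1 := (Finset.card_le_card hsub).trans (Finset.card_insert_le _ _)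
    have h2 := hj.perm.length_eq
    rw [List.length_cons] at h2
    have h3 : (σ.begin r j Q).queue = Q := rfl
    have h4 : (σ.begin r j Q).resting = σ.resting := rfl
    rw [potential, potential, h2, h3, h4]
    omega

theorem exists_run_to_rest (σ : State I) (hσ : Consistent σ) :
    ∃ σ', Relation.ReflTransGen Step σ σ' ∧ ∀ r, r ∈ σ'.resting := by
  induction hn : potential σ using Nat.strong_induction_on generalizing σ with
  | _ n ih =>
    by_cases h : ∃ r, r ∉ σ.resting
    · obtain ⟨σ₁, h1, hlt⟩ := exists_step_potential_lt hσ h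
      obtain ⟨σ₂, h2, hrest⟩ := ih _ (hn ▸ hlt) σ₁ (hσ.step h1) rfl
      exact ⟨σ₂, Relation.ReflTransGen.head h1 h2, hrest⟩
    · push Not at h
      exact ⟨σ, Relation.ReflTransGen.refl, h⟩

theorem exists_isSortedTaskList (I : Instance) : ∃ L : List I.Task, IsSortedTaskList L := by
  let r : I.Task → I.Task → Prop := fun i j => I.accel i ≤ I.accel j
  have : DecidableRel r := Classical.decRel _
  have : Std.Total r := ⟨fun i j => le_total _ _⟩
  have : IsTrans I.Task r := ⟨fun i j k h h' => le_trans h h'⟩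
  refine ⟨(List.finRange I.n).insertionSort r, ?_, fun j => ?_, ?_⟩
  · exact (List.perm_insertionSort r _).nodup_iff.2 (List.nodup_finRange _)
  · exact (List.perm_insertionSort r _).mem_iff.2 (List.mem_finRange _)
  · exact List.pairwise_insertionSort r _

theorem resource_nonempty (I : Instance) : Nonempty I.Resource :=
  ⟨Sum.inr ⟨0, I.one_le_k⟩⟩

/-- Once all resources rest, every task has been placed: a resource rests only when the list is
empty. -/
theorem Consistent.exists_place {σ : State I} (hσ : Consistent σ) (h : ∀ r, r ∈ σ.resting)
    (j : I.Task) : ∃ x, σ.place j = some x := by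
  obtain ⟨r⟩ := resource_nonempty I
  have h1 := hσ.queue_eq_nil r (h r)
  have h2 := hσ.mem_queue j
  rw [h1] at h2
  exact Option.ne_none_iff_exists'.1 fun h => by simpa using h2.2 h

theorem exists_output (I : Instance) : ∃ S, Output I S := by
  obtain ⟨L, hL⟩ := exists_isSortedTaskList I
  obtain ⟨σ, hrun, hrest⟩ := exists_run_to_rest (initial L) (consistent_initial hL)
  choose f hf using ((consistent_initial hL).steps hrun).exists_place hrest
  exact ⟨⟨fun j => (f j).1, fun j => (f j).2⟩, L, σ, hL, hrun, hrest, hf⟩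

end HeteroPrio

/-! ### Loads of the resources -/

theorem Instance.time_congr (I : Instance) (j : I.Task) {r r' : I.Resource}
    (h : r.isLeft = r'.isLeft) : I.time j r = I.time j r' := by
  cases r <;> cases r' <;> first | rfl | simp at h

namespace Schedule

variable {I : Instance}

theorem completion_le_makespan (S : Schedule I) (j : I.Task) : S.completion j ≤ S.makespan :=
  le_ciSup (Set.finite_range S.completion).bddAbove j

theorem Feasible.sum_time_le {S : Schedule I} (hS : S.Feasible) (r : I.Resource) {B : ℝ}
    (hB : 0 ≤ B) (F : Finset I.Task) (hF : ∀ j ∈ F, S.proc j = r ∧ S.completion j ≤ B) :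
    ∑ j ∈ F, I.time j r ≤ B := by
  classical
  induction hn : F.card generalizing F B with
  | zero => simpa [Finset.card_eq_zero.1 hn] using hB
  | succ n ih =>
    obtain ⟨j, hj, hmax⟩ := F.exists_max_image S.start (Finset.card_pos.1 (by omega))
    have hlast : ∑ i ∈ F.erase j, I.time i r ≤ S.start j := by
      refine ih (hS.1 j) (F.erase j) (fun i hi => ?_) (by rw [Finset.card_erase_of_mem hj]; omega)
      obtain ⟨hij, hi⟩ := Finset.mem_erase.1 hi
      refine ⟨(hF i hi).1, ?_⟩
      rcases hS.2 i j hij ((hF i hi).1.trans (hF j hj).1.symm) with h | h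
      · exact h
      · have h1 := hmax i hi
        have h2 := I.time_pos j (S.proc j)
        unfold completion at h
        linarith
    have h1 := (hF j hj).2
    rw [completion, (hF j hj).1] at h1
    rw [← Finset.add_sum_erase F _ hj]
    linarith

theorem Feasible.makespan_nonneg {S : Schedule I} (hS : S.Feasible) : 0 ≤ S.makespan := by
  refine Real.iSup_nonneg fun j => ?_
  have := hS.1 j
  have := I.time_pos j (S.proc j)
  unfold completion
  linarith

/-- In a feasible schedule, the total time of the tasks of a resource is at most the makespan. -/
theorem Feasible.load_le_makespan {S : Schedule I} (hS : S.Feasible) (r : I.Resource) :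
    ∑ j with S.proc j = r, I.time j r ≤ S.makespan := by
  exact hS.sum_time_le r hS.makespan_nonneg _ fun j hj =>
    ⟨(Finset.mem_filter.1 hj).2, S.completion_le_makespan j⟩

end Schedule

namespace HeteroPrio

variable {I : Instance}

/-! ### The list phase -/

open Classical in
/-- The total time on `r` of the tasks assigned to `r`. -/
noncomputable def load (σ : State I) (r : I.Resource) : ℝ :=
  ∑ j with ∃ s, σ.place j = some (r, s), I.time j r

/-- The part of the invariant that only holds until the first spoliation or rest. The tasks of a
prefix `X` of the sorted list have been started on CPUs, those of a suffix `Y` on GPUs, and no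
resource has been idle. -/
structure ListPhase (L : List I.Task) (σ : State I) : Prop where
  consistent : Consistent σ
  split : ∃ X Y, L = X ++ (σ.queue ++ Y) ∧
    (∀ j ∈ X, ∃ c s, σ.place j = some (Sum.inl c, s)) ∧
    ∀ j ∈ Y, ∃ g s, σ.place j = some (Sum.inr g, s)
  avail_eq : ∀ r, σ.avail r = load σ r
  last : ∀ r, σ.avail r = 0 ∨ ∃ j s, σ.place j = some (r, s) ∧ σ.avail r = s + I.time j r
  resting_eq : σ.resting = ∅

theorem listPhase_initial {L : List I.Task} (hL : IsSortedTaskList L) :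
    ListPhase L (initial L) where
  consistent := consistent_initial hL
  split := ⟨[], [], by simp [initial], by simp, by simp⟩
  avail_eq r := by simp [initial, load]
  last r := Or.inl rfl
  resting_eq := rfl

theorem ListPhase.begin {L : List I.Task} {σ : State I} (h : ListPhase L σ) {r : I.Resource}
    {j : I.Task} {Q : List I.Task} (hidle : FirstIdle σ r) (hQ : Pops σ.queue r j Q) :
    ListPhase L (σ.begin r j Q) := by
  classical
  have hj : σ.place j = none :=
    (h.consistent.mem_queue j).1 (hQ.perm.mem_iff.2 List.mem_cons_self)
  refine ⟨h.consistent.begin hidle hQ, ?_, fun q => ?_, fun q => ?_, h.resting_eq⟩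
  · obtain ⟨X, Y, hL, hX, hY⟩ := h.split
    have key : ∀ (i : I.Task) (x : I.Resource × ℝ), i ≠ j → σ.place i = some x →
        (σ.begin r j Q).place i = some x := by
      intro i x hij hi
      simpa [State.begin, hij] using hi
    have hne : ∀ i x, σ.place i = some x → i ≠ j := by
      rintro i x hi rfl
      simp [hj] at hi
    rcases hQ with ⟨hr, hQ⟩ | ⟨hr, hQ⟩ <;> rcases r with c | g <;> simp at hr
    · refine ⟨X ++ [j], Y, by simp [hL, hQ, State.begin], fun i hi => ?_, fun i hi => ?_⟩
      · rcases List.mem_append.1 hi with hi | hi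
        · obtain ⟨c', s, hi⟩ := hX i hi
          exact ⟨c', s, key _ _ (hne _ _ hi) hi⟩
        · obtain rfl := List.mem_singleton.1 hi
          exact ⟨c, σ.avail (Sum.inl c), by simp [State.begin]⟩
      · obtain ⟨g, s, hi⟩ := hY i hi
        exact ⟨g, s, key _ _ (hne _ _ hi) hi⟩
    · refine ⟨X, j :: Y, by simp [hL, hQ, State.begin], fun i hi => ?_, fun i hi => ?_⟩
      · obtain ⟨c, s, hi⟩ := hX i hi
        exact ⟨c, s, key _ _ (hne _ _ hi) hi⟩
      · rcases List.mem_cons.1 hi with rfl | hi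
        · exact ⟨g, σ.avail (Sum.inr g), by simp [State.begin]⟩
        · obtain ⟨g', s, hi⟩ := hY i hi
          exact ⟨g', s, key _ _ (hne _ _ hi) hi⟩
  · by_cases hq : q = r
    · subst hq
      have : Finset.univ.filter (fun i => ∃ s, (σ.begin q j Q).place i = some (q, s)) =
          insert j (Finset.univ.filter fun i => ∃ s, σ.place i = some (q, s)) := by
        ext i
        simp only [Finset.mem_filter, Finset.mem_univ, true_and, Finset.mem_insert]
        by_cases hij : i = j <;> simp [State.begin, hij]
      rw [load, this, Finset.sum_insert (by simp [hj])]
      have h1 := h.avail_eq q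
      rw [load] at h1
      simp [State.begin, h1, add_comm]
    · have : Finset.univ.filter (fun i => ∃ s, (σ.begin r j Q).place i = some (q, s)) =
          Finset.univ.filter fun i => ∃ s, σ.place i = some (q, s) := by
        ext i
        simp only [Finset.mem_filter, Finset.mem_univ, true_and]
        by_cases hij : i = j <;> simp [State.begin, hij, hj, Ne.symm hq]
      rw [load, this]
      simpa [State.begin, hq, load] using h.avail_eq q
  · by_cases hq : q = r
    · subst hq
      exact Or.inr ⟨j, σ.avail q, by simp [State.begin], by simp [State.begin]⟩
    · rcases h.last q with h0 | ⟨i, s, hi, hs⟩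
      · exact Or.inl (by simpa [State.begin, hq] using h0)
      · have hij : i ≠ j := by rintro rfl; simp [hj] at hi
        exact Or.inr ⟨i, s, by simpa [State.begin, hij] using hi,
          by simpa [State.begin, hq] using hs⟩

/-- Every run that lets a resource rest passes through the state in which the list has just become
empty. -/
theorem exists_listPhase_queue_eq_nil {L : List I.Task} (hL : IsSortedTaskList L) {σ : State I}
    (hrun : Relation.ReflTransGen Step (initial L) σ) (hrest : ∃ r, r ∈ σ.resting) :
    ∃ σ₀, ListPhase L σ₀ ∧ σ₀.queue = [] ∧ Relation.ReflTransGen Step σ₀ σ := by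
  have key : ListPhase L σ ∨
      ∃ σ₀, ListPhase L σ₀ ∧ σ₀.queue = [] ∧ Relation.ReflTransGen Step σ₀ σ := by
    clear hrest
    induction hrun with
    | refl => exact Or.inl (listPhase_initial hL)
    | @tail σ₁ σ₂ _ hstep ih =>
      rcases ih with ih | ⟨σ₀, h0, hQ, h1⟩
      · rcases hstep.cases_begin with ⟨r, j, Q, hidle, hQ, rfl⟩ |
          ⟨r, j, r', s, -, hQ, -⟩ | ⟨r, -, hQ, -⟩
        · exact Or.inl (ih.begin hidle hQ)
        · exact Or.inr ⟨σ₁, ih, hQ, Relation.ReflTransGen.single hstep⟩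
        · exact Or.inr ⟨σ₁, ih, hQ, Relation.ReflTransGen.single hstep⟩
      · exact Or.inr ⟨σ₀, h0, hQ, h1.tail hstep⟩
  refine key.resolve_left fun h => ?_
  obtain ⟨r, hr⟩ := hrest
  simp [h.resting_eq] at hr

theorem ListPhase.exists_place {L : List I.Task} {σ : State I} (h : ListPhase L σ)
    (hQ : σ.queue = []) (j : I.Task) : ∃ r s, σ.place j = some (r, s) := by
  have h2 := h.consistent.mem_queue j
  rw [hQ] at h2
  obtain ⟨x, hx⟩ := Option.ne_none_iff_exists'.1 fun h => by simpa using h2.2 h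
  exact ⟨x.1, x.2, hx⟩

theorem ListPhase.accel_le {L : List I.Task} (hL : IsSortedTaskList L) {σ : State I}
    (h : ListPhase L σ) (hQ : σ.queue = []) {i j : I.Task} {c : Fin I.m} {g : Fin I.k} {s u : ℝ}
    (hi : σ.place i = some (Sum.inl c, s)) (hj : σ.place j = some (Sum.inr g, u)) :
    I.accel i ≤ I.accel j := by
  obtain ⟨X, Y, hXY, hX, hY⟩ := h.split
  rw [hQ, List.nil_append] at hXY
  have hiX : i ∈ X := by
    have := hL.2.1 i
    rw [hXY, List.mem_append] at this
    refine this.resolve_right fun h => ?_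
    obtain ⟨g, s, h⟩ := hY i h
    simp [hi] at h
  have hjY : j ∈ Y := by
    have := hL.2.1 j
    rw [hXY, List.mem_append] at this
    refine this.resolve_left fun h => ?_
    obtain ⟨g, s, h⟩ := hX j h
    simp [hj] at h
  have := hL.2.2
  rw [hXY] at this
  exact (List.pairwise_append.1 this).2.2 i hiX j hjY

/-- A form of `ListPhase.accel_le` in which CPUs and GPUs play the same role. -/
theorem ListPhase.cross_le {L : List I.Task} (hL : IsSortedTaskList L) {σ : State I}
    (h : ListPhase L σ) (hQ : σ.queue = []) {i j : I.Task} {r r' : I.Resource} {s u : ℝ}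
    (hi : σ.place i = some (r, s)) (hj : σ.place j = some (r', u)) (hr : r.isLeft ≠ r'.isLeft) :
    I.time i r * I.time j r' ≤ I.time i r' * I.time j r := by
  rcases r with c | g <;> rcases r' with c' | g' <;> simp at hr
  · have := h.accel_le hL hQ hi hj
    rw [Instance.accel, Instance.accel, div_le_div_iff₀ (I.gpuTime_pos i) (I.gpuTime_pos j)] at this
    simp only [Instance.time]
    linarith
  · have := h.accel_le hL hQ hj hi
    rw [Instance.accel, Instance.accel, div_le_div_iff₀ (I.gpuTime_pos j) (I.gpuTime_pos i)] at this
    simp only [Instance.time]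
    linarith

/-- The list phase is optimal for the work that it completes: if no resource is idle before `T`,
then no assignment of the tasks has all its loads below `T`. With the right price `a` for a unit of
GPU time against a unit of CPU time, every task is at its cheapest place. -/
theorem ListPhase.le_of_load_le {L : List I.Task} (hL : IsSortedTaskList L) {σ : State I}
    (h : ListPhase L σ) (hQ : σ.queue = []) {T C : ℝ} (hT : ∀ r, T ≤ σ.avail r)
    (o : I.Task → I.Resource) (ho : ∀ r, ∑ j with o j = r, I.time j r ≤ C) : T ≤ C := by
  classical
  obtain ⟨r₀⟩ := resource_nonempty I
  have hC : 0 ≤ C := (Finset.sum_nonneg fun j _ => (I.time_pos j r₀).le).trans (ho r₀)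
  rcases le_or_gt T 0 with hT0 | hT0
  · exact hT0.trans hC
  choose proc start hplace using h.exists_place hQ
  have hload : ∀ r, σ.avail r = ∑ j with proc j = r, I.time j r := by
    intro r
    rw [h.avail_eq, load]
    refine Finset.sum_congr (Finset.filter_congr fun j _ => ?_) fun _ _ => rfl
    simp [hplace]
  obtain ⟨a, ha, hcpu, hgpu⟩ : ∃ a : ℝ, 0 < a ∧
      (∀ j c, proc j = Sum.inl c → I.cpuTime j ≤ a * I.gpuTime j) ∧
      ∀ j g, proc j = Sum.inr g → a * I.gpuTime j ≤ I.cpuTime j := by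
    let c₀ : Fin I.m := ⟨0, I.one_le_k.trans I.k_le_m⟩
    have hne : (Finset.univ.filter fun j => (proc j).isLeft = true).Nonempty := by
      by_contra hempty
      rw [Finset.not_nonempty_iff_eq_empty, Finset.filter_eq_empty_iff] at hempty
      have h0 := hload (Sum.inl c₀)
      rw [Finset.filter_eq_empty_iff.2 fun j hj hp => hempty hj (by simp [hp]),
        Finset.sum_empty] at h0
      linarith [hT (Sum.inl c₀)]
    obtain ⟨j₀, hj₀, hmax⟩ := Finset.exists_max_image _ I.accel hne
    obtain ⟨c₁, hc₁⟩ := Sum.isLeft_iff.1 (Finset.mem_filter.1 hj₀).2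
    refine ⟨I.accel j₀, div_pos (I.cpuTime_pos _) (I.gpuTime_pos _), fun j c hj => ?_,
      fun j g hj => ?_⟩
    · have := hmax j (by simp [hj])
      rwa [Instance.accel, div_le_iff₀ (I.gpuTime_pos j)] at this
    · have h1 := hplace j₀
      have h2 := hplace j
      rw [hc₁] at h1
      rw [hj] at h2
      have := h.accel_le hL hQ h1 h2
      exact (le_div_iff₀ (I.gpuTime_pos j)).1 this
  let w : I.Resource → ℝ := Sum.elim (fun _ => 1) fun _ => a
  have hw : ∀ r, 0 < w r := by rintro (c | g) <;> simp [w, ha]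
  have hcheap : ∀ j r, w (proc j) * I.time j (proc j) ≤ w r * I.time j r := by
    intro j r
    rcases hp : proc j with c | g <;> rcases r with c' | g' <;> simp only [w, Instance.time,
      Sum.elim_inl, Sum.elim_inr, one_mul, le_refl]
    · exact hcpu j c hp
    · exact hgpu j g hp
  have hsum : ∀ p : I.Task → I.Resource,
      ∑ r, w r * ∑ j with p j = r, I.time j r = ∑ j, w (p j) * I.time j (p j) := by
    intro p
    rw [← Finset.sum_fiberwise Finset.univ p]
    refine Finset.sum_congr rfl fun r _ => ?_
    rw [Finset.mul_sum]
    refine Finset.sum_congr rfl fun j hj => ?_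
    rw [(Finset.mem_filter.1 hj).2]
  have hW : 0 < ∑ r, w r := Finset.sum_pos (fun r _ => hw r) ⟨r₀, Finset.mem_univ _⟩
  refine le_of_mul_le_mul_left ?_ hW
  calc (∑ r, w r) * T = ∑ r, w r * T := Finset.sum_mul _ _ _
    _ ≤ ∑ r, w r * σ.avail r :=
        Finset.sum_le_sum fun r _ => mul_le_mul_of_nonneg_left (hT r) (hw r).le
    _ = ∑ j, w (proc j) * I.time j (proc j) := by simp only [hload, hsum]
    _ ≤ ∑ j, w (o j) * I.time j (o j) := Finset.sum_le_sum fun j _ => hcheap j (o j)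
    _ = ∑ r, w r * ∑ j with o j = r, I.time j r := (hsum o).symm
    _ ≤ ∑ r, w r * C := Finset.sum_le_sum fun r _ => mul_le_mul_of_nonneg_left (ho r) (hw r).le
    _ = (∑ r, w r) * C := (Finset.sum_mul _ _ _).symm

/-- When the list becomes empty, all tasks have been started by a time `T` that is at most the
makespan of any schedule. -/
theorem ListPhase.exists_start_le {L : List I.Task} (hL : IsSortedTaskList L) {σ : State I}
    (h : ListPhase L σ) (hQ : σ.queue = []) :
    ∃ T, 0 ≤ T ∧ (∀ r, T ≤ σ.avail r) ∧ (∀ j r s, σ.place j = some (r, s) → s ≤ T) ∧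
      ∀ (o : I.Task → I.Resource) (C : ℝ), (∀ r, ∑ j with o j = r, I.time j r ≤ C) → T ≤ C := by
  have := resource_nonempty I
  obtain ⟨r₀, -, hr₀⟩ := Finset.univ.exists_min_image σ.avail Finset.univ_nonempty
  refine ⟨σ.avail r₀, h.consistent.avail_nonneg _, fun r => hr₀ r (Finset.mem_univ _),
    fun j r s hj => h.consistent.start_le _ _ _ hj r₀ (by simp [h.resting_eq]),
    fun o C ho => h.le_of_load_le hL hQ (fun r => hr₀ r (Finset.mem_univ _)) o ho⟩

/-! ### Completion times after the list phase -/

theorem Step.queue_eq_nil {σ σ' : State I} (h : Step σ σ') (hQ : σ.queue = []) :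
    σ'.queue = [] := by
  rcases h.cases_begin with ⟨r, j, Q, -, hp, rfl⟩ | ⟨r, j, r', s, -, -, -, -, rfl⟩ |
    ⟨r, -, -, -, rfl⟩
  · have := hp.perm
    simp [hQ] at this
  · rfl
  · rfl

/-- The completion time of a placed task (`0` for a task that has not been started). -/
def finish (σ : State I) (j : I.Task) : ℝ :=
  (σ.place j).elim 0 fun x => x.2 + I.time j x.1

theorem finish_eq {σ : State I} {j : I.Task} {r : I.Resource} {s : ℝ}
    (h : σ.place j = some (r, s)) : finish σ j = s + I.time j r := by
  simp [finish, h]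

theorem Step.finish_le {σ σ' : State I} (h : Step σ σ') (hQ : σ.queue = []) (j : I.Task) :
    finish σ' j ≤ finish σ j := by
  rcases h.cases_begin with ⟨r, i, Q, -, hp, rfl⟩ | ⟨r, i, r', s, -, -, hc, -, rfl⟩ |
    ⟨r, -, -, -, rfl⟩
  · have := hp.perm
    simp [hQ] at this
  · by_cases hij : j = i
    · subst hij
      rw [finish_eq hc.1]
      simpa [finish, State.takeOver] using hc.2.2.le
    · simp [finish, State.takeOver, hij]
  · exact le_rfl

theorem finish_le_of_steps {σ σ' : State I} (h : Relation.ReflTransGen Step σ σ')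
    (hQ : σ.queue = []) : σ'.queue = [] ∧ ∀ j, finish σ' j ≤ finish σ j := by
  induction h with
  | refl => exact ⟨hQ, fun j => le_rfl⟩
  | tail _ hstep ih => exact ⟨hstep.queue_eq_nil ih.1, fun j =>
      (hstep.finish_le ih.1 j).trans (ih.2 j)⟩

/-- Every output arises from a state in which the list has just become empty. -/
theorem Output.exists_listPhase {S : Schedule I} (hS : Output I S) :
    ∃ L σ₀ σ, IsSortedTaskList L ∧ ListPhase L σ₀ ∧ σ₀.queue = [] ∧
      Relation.ReflTransGen Step σ₀ σ ∧ (∀ r, r ∈ σ.resting) ∧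
      ∀ j, finish σ j = S.completion j := by
  obtain ⟨L, σ, hL, hrun, hrest, hplace⟩ := hS
  obtain ⟨r⟩ := resource_nonempty I
  obtain ⟨σ₀, h0, hQ, h1⟩ := exists_listPhase_queue_eq_nil hL hrun ⟨r, hrest r⟩
  exact ⟨L, σ₀, σ, hL, h0, hQ, h1, hrest, fun j => finish_eq (hplace j)⟩

/-! ### Optimal makespan -/

theorem le_optMakespan {B : ℝ} (h : ∀ S : Schedule I, S.Feasible → B ≤ S.makespan) :
    B ≤ I.optMakespan := by
  obtain ⟨S, hS⟩ := exists_output I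
  refine le_csInf ⟨_, S, hS.feasible, rfl⟩ ?_
  rintro C ⟨S', hS', rfl⟩
  exact h S' hS'

theorem optMakespan_nonneg (I : Instance) : 0 ≤ I.optMakespan :=
  le_optMakespan fun _ hS => hS.makespan_nonneg

/-- If no task is longer than the optimal makespan, then every task is started by the optimal
makespan and lasts at most as long; spoliations only make it finish earlier. -/
theorem Output.makespan_le_two_mul {S : Schedule I} (hS : Output I S)
    (h : ∀ j, I.cpuTime j ≤ I.optMakespan ∧ I.gpuTime j ≤ I.optMakespan) :
    S.makespan ≤ 2 * I.optMakespan := by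
  obtain ⟨L, σ₀, σ, hL, h0, hQ, hrun, -, hfin⟩ := hS.exists_listPhase
  obtain ⟨T, -, -, hstart, hT⟩ := h0.exists_start_le hL hQ
  have hTC : T ≤ I.optMakespan :=
    le_optMakespan fun S' hS' => hT S'.proc _ fun r => hS'.load_le_makespan r
  refine Real.iSup_le (fun j => ?_) (by linarith [optMakespan_nonneg I])
  obtain ⟨r, s, hj⟩ := h0.exists_place hQ j
  have h1 := (finish_le_of_steps hrun hQ).2 j
  rw [hfin, finish_eq hj] at h1
  have h2 := hstart _ _ _ hj
  have h3 : I.time j r ≤ I.optMakespan := by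
    rcases r with c | g
    · exact (h j).1
    · exact (h j).2
  linarith

/-! ### The upper bound -/

theorem sqrt_two_bounds : 1 < Real.sqrt 2 ∧ Real.sqrt 2 ^ 2 = 2 :=
  ⟨Real.lt_sqrt_of_sq_lt (by norm_num), Real.sq_sqrt (by norm_num)⟩

/-- What a task `j₀` that completes late tells about the run. The task has been started on `r₀`;
the resources of the other kind are those that matter.
* A task is where the list phase put it, unless it moved from the kind of `r₀` to the other kind;
  in that case its time on `r₀` is above `C`, so that an assignment with loads at most `C` has it
  on the other kind, too.
* The resources of the other kind are never interrupted.
* They are all busy until `j₀` could be processed there without gaining anything. -/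
structure LateTask (σ₀ : State I) (j₀ : I.Task) (r₀ : I.Resource) (C : ℝ) (σ : State I) :
    Prop where
  place_eq_or : ∀ i, σ.place i = σ₀.place i ∨
    ((∃ q s, σ.place i = some (q, s) ∧ q.isLeft ≠ r₀.isLeft) ∧
      (∃ q s, σ₀.place i = some (q, s) ∧ q.isLeft = r₀.isLeft) ∧ C < I.time i r₀)
  avail_eq : ∀ q, q.isLeft ≠ r₀.isLeft → ∀ F : Finset I.Task,
    (∀ i, i ∈ F ↔ (∃ s, σ.place i = some (q, s)) ∧
      ∃ q' s, σ₀.place i = some (q', s) ∧ q'.isLeft = r₀.isLeft) →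
    σ.avail q = σ₀.avail q + ∑ i ∈ F, I.time i q
  finish_le : ∀ q, q.isLeft ≠ r₀.isLeft →
    (q ∈ σ.resting ∨ ∃ q' s, σ.place j₀ = some (q', s) ∧ q'.isLeft ≠ r₀.isLeft) →
    finish σ j₀ ≤ σ.avail q + I.time j₀ q

theorem lateTask_refl {L : List I.Task} {σ₀ : State I} (h₀ : ListPhase L σ₀) {j₀ : I.Task}
    {r₀ : I.Resource} {s₀ C : ℝ} (hj₀ : σ₀.place j₀ = some (r₀, s₀)) :
    LateTask σ₀ j₀ r₀ C σ₀ where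
  place_eq_or i := Or.inl rfl
  avail_eq q hq F hF := by
    rw [Finset.eq_empty_of_forall_notMem (s := F), Finset.sum_empty, add_zero]
    rintro i hi
    obtain ⟨⟨s, h1⟩, q', s', h2, h3⟩ := (hF i).1 hi
    rw [h1] at h2
    simp only [Option.some.injEq, Prod.mk.injEq] at h2
    rw [h2.1] at hq
    exact hq h3
  finish_le q hq h := by
    rcases h with h | ⟨q', s, h, h'⟩
    · simp [h₀.resting_eq] at h
    · rw [hj₀] at h
      simp only [Option.some.injEq, Prod.mk.injEq] at h
      rw [h.1] at h'
      exact absurd rfl h'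

theorem isLeft_eq_of_ne {r r' r₀ : I.Resource} (h : r.isLeft ≠ r₀.isLeft)
    (h' : r'.isLeft ≠ r₀.isLeft) : r.isLeft = r'.isLeft := by
  revert h h'
  cases r.isLeft <;> cases r'.isLeft <;> cases r₀.isLeft <;> simp

/-- A task placed by the list phase on the other kind than `r₀` is fast there, because its
acceleration factor compares with that of `j₀`. -/
theorem ListPhase.time_mul_le {L : List I.Task} (hL : IsSortedTaskList L) {σ₀ : State I}
    (h₀ : ListPhase L σ₀) (hQ₀ : σ₀.queue = []) {j₀ i : I.Task} {r₀ q : I.Resource} {s₀ s C : ℝ}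
    (hj₀ : σ₀.place j₀ = some (r₀, s₀)) (hi : σ₀.place i = some (q, s))
    (hq : q.isLeft ≠ r₀.isLeft) (hy : I.time j₀ q ≤ C)
    (hx : (1 + Real.sqrt 2) * C < I.time j₀ r₀) :
    I.time i q ≤ (Real.sqrt 2 - 1) * I.time i r₀ := by
  have h1 := h₀.cross_le hL hQ₀ hi hj₀ hq
  have h2 := I.time_pos i q
  have h3 := I.time_pos i r₀
  have h4 := I.time_pos j₀ q
  obtain ⟨h5, h6⟩ := sqrt_two_bounds
  have hC : 0 < C := h4.trans_le hy
  have h7 : I.time i q * ((1 + Real.sqrt 2) * C) ≤ I.time i r₀ * C :=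
    (mul_le_mul_of_nonneg_left hx.le h2.le).trans
      (h1.trans (mul_le_mul_of_nonneg_left hy h3.le))
  have h8 : I.time i q * (1 + Real.sqrt 2) ≤ I.time i r₀ := by
    refine le_of_mul_le_mul_right ?_ hC
    linarith
  -- `(√2 - 1) * (√2 + 1) = 1`
  have h9 := mul_le_mul_of_nonneg_left h8 (show 0 ≤ Real.sqrt 2 - 1 by linarith)
  nlinarith

theorem LateTask.step {L : List I.Task} (hL : IsSortedTaskList L) {σ₀ σ σ' : State I}
    (h₀ : ListPhase L σ₀) (hQ₀ : σ₀.queue = []) {j₀ : I.Task} {r₀ : I.Resource} {s₀ C T : ℝ}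
    (hj₀ : σ₀.place j₀ = some (r₀, s₀))
    (hT : ∀ j r s, σ₀.place j = some (r, s) → s ≤ T) (hTC : T ≤ C)
    (hy : ∀ q : I.Resource, q.isLeft ≠ r₀.isLeft → I.time j₀ q ≤ C)
    (hx : (1 + Real.sqrt 2) * C < I.time j₀ r₀)
    (ho : ∀ i, C < I.time i r₀ → ∀ q : I.Resource, q.isLeft ≠ r₀.isLeft → I.time i q ≤ C)
    (hσ : Consistent σ) (hQ : σ.queue = []) (h : LateTask σ₀ j₀ r₀ C σ) (hstep : Step σ σ')
    (hlate : (2 + Real.sqrt 2) * C < finish σ' j₀) : LateTask σ₀ j₀ r₀ C σ' := by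
  classical
  have hlate' := hlate.trans_le (hstep.finish_le hQ j₀)
  obtain ⟨h2a, h2b⟩ := sqrt_two_bounds
  obtain ⟨r₁, s₁, hj₁⟩ : ∃ r₁ s₁, σ.place j₀ = some (r₁, s₁) := by
    rcases h.place_eq_or j₀ with h1 | ⟨⟨q, s, h1, -⟩, -⟩
    · exact ⟨r₀, s₀, h1.trans hj₀⟩
    · exact ⟨q, s, h1⟩
  have hr₁ : r₁ = r₀ ∨ r₁.isLeft ≠ r₀.isLeft := by
    rcases h.place_eq_or j₀ with h1 | ⟨⟨q, s, h1, h2⟩, -⟩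
    · rw [hj₁, hj₀] at h1
      simp only [Option.some.injEq, Prod.mk.injEq] at h1
      exact Or.inl h1.1
    · rw [hj₁] at h1
      simp only [Option.some.injEq, Prod.mk.injEq] at h1
      rw [h1.1]
      exact Or.inr h2
  have hfin := finish_eq hj₁
  -- a resource of the other kind that is not resting either is late or sees `j₀` as a candidate
  have hcand : ∀ r, FirstIdle σ r → r.isLeft ≠ r₀.isLeft →
      finish σ j₀ ≤ σ.avail r + I.time j₀ r ∨ Candidate σ r j₀ r₁ s₁ := by
    intro r _ hr
    rcases hr₁ with rfl | hr₁
    · rcases le_or_gt (finish σ j₀) (σ.avail r + I.time j₀ r) with hle | hlt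
      · exact Or.inl hle
      · refine Or.inr ⟨hj₁, ?_, by rwa [← hfin]⟩
        rintro rfl
        exact hr rfl
    · exact Or.inl (h.finish_le r hr (Or.inr ⟨r₁, s₁, hj₁, hr₁⟩))
  rcases hstep.cases_begin with ⟨r, i, Q, -, hp, rfl⟩ | ⟨r, i, r', s, hidle, -, hc, hmax, rfl⟩ |
    ⟨r, hidle, -, hnone, rfl⟩
  · have := hp.perm
    simp [hQ] at this
  · have hlt := hc.time_lt hσ hidle.1
    have hkind : r.isLeft ≠ r'.isLeft := fun heq => by
      rw [I.time_congr i heq] at hlt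
      exact lt_irrefl _ hlt
    -- nothing moves back from the other kind
    have hr' : r'.isLeft = r₀.isLeft := by
      by_contra hr'
      have hr : r.isLeft = r₀.isLeft := by
        revert hkind hr'
        cases r.isLeft <;> cases r'.isLeft <;> cases r₀.isLeft <;> simp
      rw [I.time_congr i hr] at hlt
      rcases h.place_eq_or i with h1 | ⟨-, -, h1⟩
      · rw [hc.1] at h1
        have h3 := h₀.time_mul_le hL hQ₀ hj₀ h1.symm hr' (hy r' hr') hx
        have h4 := I.time_pos i r₀
        have h5 : Real.sqrt 2 < 2 := by nlinarith
        nlinarith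
      · linarith [ho i h1 r' hr']
    have hr : r.isLeft ≠ r₀.isLeft := by rwa [hr'] at hkind
    have hi₀ : σ₀.place i = some (r', s) := by
      rcases h.place_eq_or i with h1 | ⟨⟨q, u, h1, h2⟩, -⟩
      · rw [← h1, hc.1]
      · rw [hc.1] at h1
        simp only [Option.some.injEq, Prod.mk.injEq] at h1
        rw [← h1.1] at h2
        exact absurd hr' h2
    have hlong : C < I.time i r₀ := by
      have h3 : (1 + Real.sqrt 2) * C < s + I.time i r' := by
        rcases hcand r hidle hr with h3 | h3
        · have h4 := hy r hr
          have h5 := hc.2.2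
          have h6 := I.time_pos i r
          linarith
        · have h4 := hmax _ _ _ h3
          have h5 : 0 ≤ C := (I.time_pos j₀ r).le.trans (hy r hr)
          linarith
      have h4 := hT _ _ _ hi₀
      have h5 : 0 < C := (I.time_pos j₀ r).trans_le (hy r hr)
      rw [I.time_congr i hr'] at h3
      nlinarith
    refine ⟨fun i' => ?_, fun q hq F hF => ?_, fun q hq hor => ?_⟩
    · by_cases hii : i' = i
      · subst hii
        exact Or.inr ⟨⟨r, σ.avail r, by simp [State.takeOver], hr⟩, ⟨r', s, hi₀, hr'⟩, hlong⟩
      · simpa [State.takeOver, hii] using h.place_eq_or i'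
    · have hq' : q ≠ r' := by
        rintro rfl
        exact hq hr'
      by_cases hqr : q = r
      · subst hqr
        have hiF : i ∈ F := (hF i).2 ⟨⟨σ.avail q, by simp [State.takeOver]⟩, r', s, hi₀, hr'⟩
        have h3 := h.avail_eq q hq (F.erase i) fun i' => by
          rw [Finset.mem_erase, hF]
          by_cases hii : i' = i
          · subst hii
            simp [hc.1, Ne.symm hq']
          · simp [State.takeOver, hii]
        rw [← Finset.add_sum_erase F _ hiF]
        simp only [State.takeOver, Function.update_self]
        linarith
      · have h3 := h.avail_eq q hq F fun i' => by
          rw [hF]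
          by_cases hii : i' = i
          · subst hii
            simp [State.takeOver, hc.1, Ne.symm hq', Ne.symm hqr]
          · simp [State.takeOver, hii]
        simpa [State.takeOver, hqr, hq'] using h3
    · have hq' : q ≠ r' := by
        rintro rfl
        exact hq hr'
      have htime : I.time j₀ q = I.time j₀ r := I.time_congr _ (isLeft_eq_of_ne hq hr)
      by_cases hij : j₀ = i
      · subst hij
        have hfin' : finish (σ.takeOver r j₀ r') j₀ = σ.avail r + I.time j₀ r :=
          finish_eq (by simp [State.takeOver])
        by_cases hqr : q = r
        · subst hqr
          have h4 := I.time_pos j₀ q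
          rw [hfin']
          simp only [State.takeOver, Function.update_self]
          linarith
        · have havail : (σ.takeOver r j₀ r').avail q = σ.avail q := by
            simp [State.takeOver, hqr, hq']
          rw [havail]
          by_cases hrest : q ∈ σ.resting
          · exact (hstep.finish_le hQ j₀).trans (h.finish_le q hq (Or.inl hrest))
          · rw [hfin', htime]
            linarith [hidle.2 q hrest]
      · have hplace : (σ.takeOver r i r').place j₀ = σ.place j₀ := by simp [State.takeOver, hij]
        have hfin' : finish (σ.takeOver r i r') j₀ = finish σ j₀ := by simp [finish, hplace]
        rw [hplace] at hor
        have h3 := h.finish_le q hq hor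
        rw [hfin']
        by_cases hqr : q = r
        · subst hqr
          have h4 := I.time_pos i q
          simp only [State.takeOver, Function.update_self]
          linarith
        · simpa [State.takeOver, hqr, hq'] using h3
  · refine ⟨h.place_eq_or, h.avail_eq, fun q hq hor => ?_⟩
    by_cases hqr : q = r
    · subst hqr
      exact (hcand q hidle hq).resolve_right (hnone _ _ _)
    · refine h.finish_le q hq (hor.imp_left fun hq' => ?_)
      simpa [State.retire, hqr] using hq'

theorem LateTask.steps {L : List I.Task} (hL : IsSortedTaskList L) {σ₀ σ : State I}
    (h₀ : ListPhase L σ₀) (hQ₀ : σ₀.queue = []) {j₀ : I.Task} {r₀ : I.Resource} {s₀ C T : ℝ}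
    (hj₀ : σ₀.place j₀ = some (r₀, s₀))
    (hT : ∀ j r s, σ₀.place j = some (r, s) → s ≤ T) (hTC : T ≤ C)
    (hy : ∀ q : I.Resource, q.isLeft ≠ r₀.isLeft → I.time j₀ q ≤ C)
    (hx : (1 + Real.sqrt 2) * C < I.time j₀ r₀)
    (ho : ∀ i, C < I.time i r₀ → ∀ q : I.Resource, q.isLeft ≠ r₀.isLeft → I.time i q ≤ C)
    (hrun : Relation.ReflTransGen Step σ₀ σ)
    (hlate : (2 + Real.sqrt 2) * C < finish σ j₀) : LateTask σ₀ j₀ r₀ C σ := by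
  induction hrun with
  | refl => exact lateTask_refl h₀ hj₀
  | @tail σ₁ σ₂ hrun hstep ih =>
    have hQ := (finish_le_of_steps hrun hQ₀).1
    exact (ih (hlate.trans_le (hstep.finish_le hQ j₀))).step hL h₀ hQ₀ hj₀ hT hTC hy hx ho
      (h₀.consistent.steps hrun) hQ hstep hlate

/-- The work on a resource `q` of the other kind than `r₀`: the time `T` of the list phase, the
rest of a last task that is short on `q` because it is not long on `r₀`, and tasks that an
assignment `o` with loads at most `C` has on the other kind as well. -/
theorem LateTask.avail_le {L : List I.Task} (hL : IsSortedTaskList L) {σ₀ σ : State I}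
    (h₀ : ListPhase L σ₀) (hQ₀ : σ₀.queue = []) {j₀ : I.Task} {r₀ : I.Resource} {s₀ C T : ℝ}
    (hj₀ : σ₀.place j₀ = some (r₀, s₀)) (hT0 : 0 ≤ T)
    (hT : ∀ j r s, σ₀.place j = some (r, s) → s ≤ T)
    (hy : ∀ q : I.Resource, q.isLeft ≠ r₀.isLeft → I.time j₀ q ≤ C)
    (hx : (1 + Real.sqrt 2) * C < I.time j₀ r₀) (o : I.Task → I.Resource)
    (ho : ∀ i, I.time i (o i) ≤ C) (h : LateTask σ₀ j₀ r₀ C σ) (q : I.Resource)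
    (hq : q.isLeft ≠ r₀.isLeft) (D : Finset I.Task)
    (hD : ∀ i, i ∈ D ↔ (∃ s, σ.place i = some (q, s)) ∧ (o i).isLeft ≠ r₀.isLeft) :
    σ.avail q ≤ T + (Real.sqrt 2 - 1) * C + ∑ i ∈ D, I.time i q := by
  classical
  obtain ⟨h2a, h2b⟩ := sqrt_two_bounds
  have hC : 0 < C := (I.time_pos j₀ q).trans_le (hy q hq)
  let F : Finset I.Task := Finset.univ.filter fun i => (∃ s, σ.place i = some (q, s)) ∧
    ∃ q' s, σ₀.place i = some (q', s) ∧ q'.isLeft = r₀.isLeft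
  have hF : ∀ i, i ∈ F ↔ (∃ s, σ.place i = some (q, s)) ∧
      ∃ q' s, σ₀.place i = some (q', s) ∧ q'.isLeft = r₀.isLeft := fun i => by simp [F]
  have hFD : F ⊆ D := by
    intro i hi
    obtain ⟨⟨s, h1⟩, q', s', h2, h3⟩ := (hF i).1 hi
    refine (hD i).2 ⟨⟨s, h1⟩, fun h4 => ?_⟩
    rcases h.place_eq_or i with h5 | ⟨-, -, h5⟩
    · rw [h1, h2] at h5
      simp only [Option.some.injEq, Prod.mk.injEq] at h5
      rw [h5.1] at hq
      exact hq h3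
    · have := ho i
      rw [I.time_congr i h4] at this
      linarith
  have hnn : ∀ i ∈ D, i ∉ F → 0 ≤ I.time i q := fun i _ _ => (I.time_pos i q).le
  rw [h.avail_eq q hq F hF]
  rcases h₀.last q with h0 | ⟨l, s, hl, hs⟩
  · have := Finset.sum_le_sum_of_subset_of_nonneg hFD hnn
    have h3 : 0 ≤ (Real.sqrt 2 - 1) * C := mul_nonneg (by linarith) hC.le
    linarith
  · have hsT := hT _ _ _ hl
    by_cases hol : (o l).isLeft = r₀.isLeft
    · have h3 := h₀.time_mul_le hL hQ₀ hj₀ hl hq (hy q hq) hx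
      have h4 := ho l
      rw [I.time_congr l hol] at h4
      have h5 := mul_le_mul_of_nonneg_left h4 (show 0 ≤ Real.sqrt 2 - 1 by linarith)
      have := Finset.sum_le_sum_of_subset_of_nonneg hFD hnn
      linarith
    · have hlF : l ∉ F := fun hlF => by
        obtain ⟨-, q', s', h2, h3⟩ := (hF l).1 hlF
        rw [hl] at h2
        simp only [Option.some.injEq, Prod.mk.injEq] at h2
        rw [h2.1] at hq
        exact hq h3
      have hlD : l ∈ D := by
        refine (hD l).2 ⟨?_, hol⟩
        rcases h.place_eq_or l with h5 | ⟨-, ⟨q', s', h5, h6⟩, -⟩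
        · exact ⟨s, h5.trans hl⟩
        · rw [hl] at h5
          simp only [Option.some.injEq, Prod.mk.injEq] at h5
          rw [← h5.1] at h6
          exact absurd h6 hq
      have h3 := Finset.sum_le_sum_of_subset_of_nonneg (f := fun i => I.time i q)
        (Finset.insert_subset hlD hFD) fun i _ _ => (I.time_pos i q).le
      rw [Finset.sum_insert hlF] at h3
      have h4 : 0 ≤ (Real.sqrt 2 - 1) * C := mul_nonneg (by linarith) hC.le
      linarith

/-- Upper bound on all completion times, relative to any assignment `o` with loads at most `C`. -/
theorem finish_le_of_load_le {L : List I.Task} (hL : IsSortedTaskList L) {σ₀ σ : State I}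
    (h₀ : ListPhase L σ₀) (hQ₀ : σ₀.queue = []) (hrun : Relation.ReflTransGen Step σ₀ σ)
    (hrest : ∀ r, r ∈ σ.resting) {C : ℝ} (o : I.Task → I.Resource)
    (ho : ∀ r, ∑ j with o j = r, I.time j r ≤ C) (j₀ : I.Task) :
    finish σ j₀ ≤ (2 + Real.sqrt 2) * C := by
  classical
  by_contra! hlate
  obtain ⟨h2a, h2b⟩ := sqrt_two_bounds
  have ho' : ∀ i, I.time i (o i) ≤ C := fun i =>
    (Finset.single_le_sum (s := Finset.univ.filter fun j => o j = o i)
      (f := fun j => I.time j (o i)) (fun j _ => (I.time_pos j _).le)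
      (Finset.mem_filter.2 ⟨Finset.mem_univ i, rfl⟩)).trans (ho (o i))
  obtain ⟨T, hT0, -, hT, hTC⟩ := h₀.exists_start_le hL hQ₀
  have hTC := hTC o C ho
  have hC : 0 < C := (I.time_pos j₀ _).trans_le (ho' j₀)
  obtain ⟨r₀, s₀, hj₀⟩ := h₀.exists_place hQ₀ j₀
  have hx : (1 + Real.sqrt 2) * C < I.time j₀ r₀ := by
    have h1 := (finish_le_of_steps hrun hQ₀).2 j₀
    rw [finish_eq hj₀] at h1
    linarith [hT _ _ _ hj₀]
  have hother : ∀ i, C < I.time i r₀ → (o i).isLeft ≠ r₀.isLeft := by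
    intro i hi heq
    have := ho' i
    rw [I.time_congr i heq] at this
    linarith
  have hfast : ∀ i, C < I.time i r₀ → ∀ q : I.Resource, q.isLeft ≠ r₀.isLeft →
      I.time i q ≤ C := by
    intro i hi q hq
    rw [I.time_congr i (isLeft_eq_of_ne hq (hother i hi))]
    exact ho' i
  have hj₀C : C < I.time j₀ r₀ := by nlinarith
  have hy := hfast j₀ hj₀C
  have h := LateTask.steps hL h₀ hQ₀ hj₀ hT hTC hy hx hfast hrun hlate
  let K : Finset I.Resource := Finset.univ.filter fun q => q.isLeft ≠ r₀.isLeft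
  have hK : ∀ q, q ∈ K ↔ q.isLeft ≠ r₀.isLeft := fun q => by simp [K]
  have hoK : o j₀ ∈ K := (hK _).2 (hother j₀ hj₀C)
  have hcard : (0 : ℝ) < K.card := by exact_mod_cast Finset.card_pos.2 ⟨_, hoK⟩
  let D : I.Resource → Finset I.Task := fun q => Finset.univ.filter fun i =>
    (∃ s, σ.place i = some (q, s)) ∧ (o i).isLeft ≠ r₀.isLeft
  have hwork : ∑ q ∈ K, ∑ i ∈ D q, I.time i q ≤ K.card * C := by
    have hpd : (K : Set I.Resource).PairwiseDisjoint D := by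
      intro q _ q' _ hqq'
      refine Finset.disjoint_left.2 fun i hi hi' => hqq' ?_
      obtain ⟨⟨s, h1⟩, -⟩ := (Finset.mem_filter.1 hi).2
      obtain ⟨⟨s', h2⟩, -⟩ := (Finset.mem_filter.1 hi').2
      rw [h1] at h2
      simp only [Option.some.injEq, Prod.mk.injEq] at h2
      exact h2.1
    calc ∑ q ∈ K, ∑ i ∈ D q, I.time i q = ∑ q ∈ K, ∑ i ∈ D q, I.time i (o i) := by
          refine Finset.sum_congr rfl fun q hq => Finset.sum_congr rfl fun i hi => ?_
          exact I.time_congr i (isLeft_eq_of_ne ((hK q).1 hq) (Finset.mem_filter.1 hi).2.2)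
      _ = ∑ i ∈ K.biUnion D, I.time i (o i) := (Finset.sum_biUnion hpd).symm
      _ ≤ ∑ i with o i ∈ K, I.time i (o i) := by
          refine Finset.sum_le_sum_of_subset_of_nonneg (fun i hi => ?_)
            fun i _ _ => (I.time_pos i _).le
          obtain ⟨q, -, hi⟩ := Finset.mem_biUnion.1 hi
          exact Finset.mem_filter.2 ⟨Finset.mem_univ _, (hK _).2 (Finset.mem_filter.1 hi).2.2⟩
      _ = ∑ q ∈ K, ∑ i with o i = q, I.time i q := by
          rw [← Finset.sum_fiberwise_of_maps_to (t := K) (g := o)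
            fun i hi => (Finset.mem_filter.1 hi).2]
          refine Finset.sum_congr rfl fun q hq => ?_
          refine Finset.sum_congr ?_ fun i hi => by rw [(Finset.mem_filter.1 hi).2]
          ext i
          simp only [Finset.mem_filter, Finset.mem_univ, true_and, and_iff_right_iff_imp]
          rintro rfl
          exact hq
      _ ≤ ∑ _q ∈ K, C := Finset.sum_le_sum fun q _ => ho q
      _ = K.card * C := by rw [Finset.sum_const, nsmul_eq_mul]
  have hsum : K.card * finish σ j₀ ≤
      K.card * (T + (Real.sqrt 2 - 1) * C + C) + ∑ q ∈ K, ∑ i ∈ D q, I.time i q := by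
    calc K.card * finish σ j₀ = ∑ _q ∈ K, finish σ j₀ := by rw [Finset.sum_const, nsmul_eq_mul]
      _ ≤ ∑ q ∈ K, (T + (Real.sqrt 2 - 1) * C + C + ∑ i ∈ D q, I.time i q) := by
          refine Finset.sum_le_sum fun q hq => ?_
          have h1 := h.finish_le q ((hK q).1 hq) (Or.inl (hrest q))
          have h2 := h.avail_le hL h₀ hQ₀ hj₀ hT0 hT hy hx o ho' q ((hK q).1 hq) (D q)
            fun i => by simp [D]
          have h3 := hy q ((hK q).1 hq)
          linarith
      _ = _ := by rw [Finset.sum_add_distrib, Finset.sum_const, nsmul_eq_mul]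
  have hle : finish σ j₀ ≤ T + (Real.sqrt 2 - 1) * C + C + C := by
    refine le_of_mul_le_mul_left ?_ hcard
    linarith
  linarith

theorem Output.makespan_le {S : Schedule I} (hS : Output I S) :
    S.makespan ≤ (2 + Real.sqrt 2) * I.optMakespan := by
  obtain ⟨L, σ₀, σ, hL, h₀, hQ, hrun, hrest, hfin⟩ := hS.exists_listPhase
  have hpos : 0 < 2 + Real.sqrt 2 := by positivity
  rw [← div_le_iff₀' hpos]
  refine le_optMakespan fun S' hS' => ?_
  rw [div_le_iff₀' hpos]
  refine Real.iSup_le (fun j => ?_) (mul_nonneg hpos.le hS'.makespan_nonneg)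
  rw [← hfin]
  exact finish_le_of_load_le hL h₀ hQ hrun hrest S'.proc (fun r => hS'.load_le_makespan r) j

theorem approximationRatio_le :
    approximationRatio Output ≤ ((2 + Real.sqrt 2 : ℝ) : EReal) := by
  refine iSup_le fun I => iSup_le fun S => iSup_le fun hS => EReal.coe_le_coe_iff.2 ?_
  exact div_le_of_le_mul₀ (optMakespan_nonneg I) (by positivity) hS.makespan_le

/-! ### Following a timetable -/

/-- Starting times for the tasks of `Z` on machines `proc`, without overlap, such that until `T`
a machine passes without delay from one task to the next. -/
structure Timetable {τ ρ : Type*} (proc : τ → ρ) (start fin : τ → ℝ) (T : ℝ) (Z : Finset τ) :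
    Prop where
  start_lt : ∀ j ∈ Z, start j < fin j
  start_le : ∀ j ∈ Z, start j ≤ T
  disjoint : ∀ i ∈ Z, ∀ j ∈ Z, i ≠ j → proc i = proc j → fin i ≤ start j ∨ fin j ≤ start i
  next : ∀ j ∈ Z, T ≤ fin j ∨ ∃ i ∈ Z, proc i = proc j ∧ start i = fin j

theorem Timetable.transport {τ τ' ρ ρ' : Type*} {proc : τ → ρ} {start fin : τ → ℝ} {T : ℝ}
    {Z : Finset τ} (ht : Timetable proc start fin T Z) (e : τ ≃ τ') {f : ρ → ρ'}
    (hf : Function.Injective f) :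
    Timetable (fun j => f (proc (e.symm j))) (fun j => start (e.symm j))
      (fun j => fin (e.symm j)) T (Z.map e.toEmbedding) where
  start_lt j hj := ht.start_lt _ (Finset.mem_map_equiv.1 hj)
  start_le j hj := ht.start_le _ (Finset.mem_map_equiv.1 hj)
  disjoint i hi j hj hij hp := ht.disjoint _ (Finset.mem_map_equiv.1 hi) _
    (Finset.mem_map_equiv.1 hj) (fun h => hij (e.symm.injective h)) (hf hp)
  next j hj := (ht.next _ (Finset.mem_map_equiv.1 hj)).imp_right fun ⟨i, hi, hp, hs⟩ =>
    ⟨e i, Finset.mem_map_equiv.2 (by simpa using hi), by simp [hp], by simp [hs]⟩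

/-- The tasks of `Z` other than those of `Q` have been started as in the timetable, in the order of
the starting times, and `avail` are the resulting idle times of the machines. -/
structure Front {τ ρ : Type*} (proc : τ → ρ) (start : τ → ℝ) (T : ℝ) (Z Q : Finset τ)
    (avail : ρ → ℝ) : Prop where
  subset : Q ⊆ Z
  started : ∀ i ∈ Z, i ∉ Q → ∀ j ∈ Q, start i ≤ start j
  avail_le : ∀ i ∈ Q, avail (proc i) ≤ start i
  busy : ∀ r, T ≤ avail r ∨ ∃ i ∈ Q, proc i = r ∧ start i = avail r

section Front

variable {τ ρ : Type*} {proc : τ → ρ} {start fin : τ → ℝ} {T : ℝ} {Z Q : Finset τ}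
  {avail : ρ → ℝ} {j : τ}

theorem Front.start_le_avail (h : Front proc start T Z Q avail)
    (ht : Timetable proc start fin T Z) (hj : j ∈ Q) (hmin : ∀ i ∈ Q, start j ≤ start i) (r : ρ) :
    start j ≤ avail r := by
  rcases h.busy r with hr | ⟨i, hi, -, hr⟩
  · exact (ht.start_le j (h.subset hj)).trans hr
  · exact (hmin i hi).trans hr.le

theorem Front.avail_eq (h : Front proc start T Z Q avail) (ht : Timetable proc start fin T Z)
    (hj : j ∈ Q) (hmin : ∀ i ∈ Q, start j ≤ start i) : avail (proc j) = start j :=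
  le_antisymm (h.avail_le j hj) (h.start_le_avail ht hj hmin _)

theorem Front.erase [DecidableEq τ] [DecidableEq ρ] (h : Front proc start T Z Q avail)
    (ht : Timetable proc start fin T Z) (hj : j ∈ Q) (hmin : ∀ i ∈ Q, start j ≤ start i) :
    Front proc start T Z (Q.erase j) (Function.update avail (proc j) (fin j)) where
  subset := (Finset.erase_subset _ _).trans h.subset
  started i hi hiQ i' hi' := by
    replace hi' := Finset.mem_of_mem_erase hi'
    by_cases hij : i = j
    · subst hij
      exact hmin i' hi'
    · exact h.started i hi (fun hq => hiQ (Finset.mem_erase.2 ⟨hij, hq⟩)) i' hi'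
  avail_le i hi := by
    obtain ⟨hij, hi⟩ := Finset.mem_erase.1 hi
    rw [Function.update_apply]
    split_ifs with hp
    · rcases ht.disjoint i (h.subset hi) j (h.subset hj) hij hp with h1 | h1
      · have := ht.start_lt i (h.subset hi)
        have := hmin i hi
        linarith
      · exact h1
    · exact h.avail_le i hi
  busy r := by
    rw [Function.update_apply]
    split_ifs with hr
    · refine (ht.next j (h.subset hj)).imp_right ?_
      rintro ⟨i, hi, hp, hs⟩
      have hlt := ht.start_lt j (h.subset hj)
      refine ⟨i, Finset.mem_erase.2 ⟨?_, ?_⟩, hp.trans hr.symm, hs⟩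
      · rintro rfl
        linarith
      · by_contra hiQ
        have := h.started i hi hiQ j hj
        linarith
    · refine (h.busy r).imp_right ?_
      rintro ⟨i, hi, hp, hs⟩
      refine ⟨i, Finset.mem_erase.2 ⟨?_, hi⟩, hp, hs⟩
      rintro rfl
      exact hr hp.symm

end Front

/-- In a list that is increasing up to some point and decreasing from there on, a minimum is at
one of the ends. -/
theorem exists_min_at_end {τ : Type*} {start : τ → ℝ} {X Y : List τ}
    (hX : X.Pairwise fun i j => start i ≤ start j) (hY : Y.Pairwise fun i j => start j ≤ start i)
    (hne : X ++ Y ≠ []) :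
    (∃ j X', X = j :: X' ∧ ∀ i ∈ X ++ Y, start j ≤ start i) ∨
      ∃ j Y', Y = Y' ++ [j] ∧ ∀ i ∈ X ++ Y, start j ≤ start i := by
  have hX' : ∀ j X', X = j :: X' → ∀ i ∈ X, start j ≤ start i := by
    rintro j X' rfl i hi
    rcases List.mem_cons.1 hi with rfl | hi
    · exact le_rfl
    · exact (List.pairwise_cons.1 hX).1 i hi
  have hY' : ∀ j Y', Y = Y' ++ [j] → ∀ i ∈ Y, start j ≤ start i := by
    rintro j Y' rfl i hi
    rcases List.mem_append.1 hi with hi | hi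
    · exact (List.pairwise_append.1 hY).2.2 i hi j (by simp)
    · rw [List.mem_singleton.1 hi]
  rcases X.eq_nil_or_concat' with hX0 | hX0
  · rcases Y.eq_nil_or_concat' with rfl | ⟨Y', j, hj⟩
    · simp [hX0] at hne
    · refine Or.inr ⟨j, Y', hj, fun i hi => hY' j Y' hj i ?_⟩
      simpa [hX0] using hi
  · obtain ⟨x, X', hx⟩ := List.exists_cons_of_ne_nil (show X ≠ [] by
      obtain ⟨L, b, rfl⟩ := hX0
      simp)
    rcases Y.eq_nil_or_concat' with hY0 | ⟨Y', y, hy⟩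
    · refine Or.inl ⟨x, X', hx, fun i hi => hX' x X' hx i ?_⟩
      simpa [hY0] using hi
    · rcases le_total (start x) (start y) with h | h
      · refine Or.inl ⟨x, X', hx, fun i hi => ?_⟩
        rcases List.mem_append.1 hi with hi | hi
        · exact hX' x X' hx i hi
        · exact h.trans (hY' y Y' hy i hi)
      · refine Or.inr ⟨y, Y', hy, fun i hi => ?_⟩
        rcases List.mem_append.1 hi with hi | hi
        · exact h.trans (hX' x X' hx i hi)
        · exact hY' y Y' hy i hi

/-- The list phase can follow any timetable in which the CPUs take the tasks of a prefix of the
list in order, and the GPUs those of the suffix in reverse order. -/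
theorem exists_listPhase_run {S : Schedule I} {T : ℝ}
    (ht : Timetable S.proc S.start S.completion T Finset.univ) (X Y : List I.Task) (σ : State I)
    (hQ : σ.queue = X ++ Y) (hnd : (X ++ Y).Nodup)
    (hX : X.Pairwise fun i j => S.start i ≤ S.start j)
    (hY : Y.Pairwise fun i j => S.start j ≤ S.start i)
    (hXc : ∀ j ∈ X, (S.proc j).isLeft = true) (hYg : ∀ j ∈ Y, (S.proc j).isLeft = false)
    (hfront : Front S.proc S.start T Finset.univ (X ++ Y).toFinset σ.avail)
    (hplace : ∀ j, j ∉ X ++ Y → σ.place j = some (S.proc j, S.start j))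
    (hrest : σ.resting = ∅)
    (havail : ∀ r, σ.avail r = 0 ∨ ∃ j, S.proc j = r ∧ σ.avail r = S.completion j) :
    ∃ σ', Relation.ReflTransGen Step σ σ' ∧ σ'.queue = [] ∧ σ'.resting = ∅ ∧
      (∀ j, σ'.place j = some (S.proc j, S.start j)) ∧ (∀ r, T ≤ σ'.avail r) ∧
      ∀ r, σ'.avail r = 0 ∨ ∃ j, S.proc j = r ∧ σ'.avail r = S.completion j := by
  induction hn : (X ++ Y).length generalizing X Y σ with
  | zero =>
    have hnil : X ++ Y = [] := List.eq_nil_of_length_eq_zero hn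
    refine ⟨σ, Relation.ReflTransGen.refl, hQ.trans hnil, hrest,
      fun j => hplace j (by simp [hnil]), fun r => ?_, havail⟩
    refine (hfront.busy r).resolve_right ?_
    rintro ⟨i, hi, -⟩
    simp [hnil] at hi
  | succ n ih =>
    have hne : X ++ Y ≠ [] := fun h => by simp [h] at hn
    -- the step common to both kinds of resources
    have main : ∀ j X' Y', j ∈ X ++ Y → (∀ i ∈ X ++ Y, S.start j ≤ S.start i) →
        Pops σ.queue (S.proc j) j (X' ++ Y') → X'.Sublist X → Y'.Sublist Y →
        ∃ σ', Relation.ReflTransGen Step σ σ' ∧ σ'.queue = [] ∧ σ'.resting = ∅ ∧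
          (∀ j, σ'.place j = some (S.proc j, S.start j)) ∧ (∀ r, T ≤ σ'.avail r) ∧
          ∀ r, σ'.avail r = 0 ∨ ∃ j, S.proc j = r ∧ σ'.avail r = S.completion j := by
      intro j X' Y' hj hmin hpops hX' hY'
      have hjF : j ∈ (X ++ Y).toFinset := List.mem_toFinset.2 hj
      have hminF : ∀ i ∈ (X ++ Y).toFinset, S.start j ≤ S.start i := fun i hi =>
        hmin i (List.mem_toFinset.1 hi)
      have heq := hfront.avail_eq ht hjF hminF
      have hidle : FirstIdle σ (S.proc j) := ⟨by simp [hrest], fun r _ => by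
        rw [heq]
        exact hfront.start_le_avail ht hjF hminF r⟩
      have hperm := hpops.perm
      rw [hQ] at hperm
      have hnd' := hperm.nodup_iff.1 hnd
      have hcomp : σ.avail (S.proc j) + I.time j (S.proc j) = S.completion j := by
        rw [heq]
        rfl
      obtain ⟨σ', h1, h2⟩ := ih X' Y' (σ.begin (S.proc j) j (X' ++ Y')) rfl hnd'.of_cons
        (hX.sublist hX') (hY.sublist hY') (fun i hi => hXc i (hX'.subset hi))
        (fun i hi => hYg i (hY'.subset hi)) (by
          have h3 := hfront.erase ht hjF hminF
          have h4 : (X ++ Y).toFinset.erase j = (X' ++ Y').toFinset := by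
            rw [List.toFinset_eq_of_perm _ _ hperm, List.toFinset_cons, Finset.erase_insert]
            simpa using (List.nodup_cons.1 hnd').1
          rw [h4, ← hcomp] at h3
          exact h3) (fun i hi => by
          by_cases hij : i = j
          · subst hij
            simp [State.begin, heq]
          · simp only [State.begin, Function.update_apply, if_neg hij]
            refine hplace i fun hi' => ?_
            rcases List.mem_cons.1 (hperm.mem_iff.1 hi') with h | h
            · exact hij h
            · exact hi h) hrest (fun r => by
          by_cases hr : r = S.proc j
          · subst hr
            exact Or.inr ⟨j, rfl, by simpa [State.begin] using hcomp⟩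
          · simpa [State.begin, hr] using havail r) (by
          have := hperm.length_eq
          rw [List.length_cons] at this
          omega)
      exact ⟨σ', Relation.ReflTransGen.head (Step.begin hidle hpops) h1, h2⟩
    rcases exists_min_at_end hX hY hne with ⟨j, X', rfl, hmin⟩ | ⟨j, Y', rfl, hmin⟩
    · exact main j X' Y (by simp) hmin (Or.inl ⟨hXc j (by simp), by simp [hQ]⟩)
        (List.sublist_cons_self _ _) (List.Sublist.refl _)
    · exact main j X Y' (by simp) hmin (Or.inr ⟨hYg j (by simp), by simp [hQ]⟩)
        (List.Sublist.refl _) (List.sublist_append_left _ _)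

/-- Resources without candidates can be left idle, those of `X` before all others. -/
theorem exists_rest_run (σ : State I) (hQ : σ.queue = []) (X : Finset I.Resource)
    (hnone : ∀ r ∈ X, r ∉ σ.resting → ∀ j r' s, ¬ Candidate σ r j r' s)
    (hle : ∀ r ∈ X, ∀ r', r' ∉ X → r' ∉ σ.resting → σ.avail r ≤ σ.avail r') :
    Relation.ReflTransGen Step σ
      { queue := [], place := σ.place, avail := σ.avail, resting := σ.resting ∪ X } := by
  induction hn : (X \ σ.resting).card generalizing σ with
  | zero =>
    have h1 : σ.resting ∪ X = σ.resting :=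
      Finset.union_eq_left.2 (Finset.sdiff_eq_empty_iff_subset.1 (Finset.card_eq_zero.1 hn))
    rw [h1, ← hQ]
  | succ n ih =>
    obtain ⟨r, hr, hmin⟩ := (X \ σ.resting).exists_min_image σ.avail
      (Finset.card_pos.1 (by omega))
    obtain ⟨hrX, hrr⟩ := Finset.mem_sdiff.1 hr
    have hidle : FirstIdle σ r := by
      refine ⟨hrr, fun r' hr' => ?_⟩
      by_cases hrX' : r' ∈ X
      · exact hmin r' (Finset.mem_sdiff.2 ⟨hrX', hr'⟩)
      · exact hle r hrX r' hrX' hr'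
    have h2 := ih (σ.retire r) rfl
      (fun q hq hqr => hnone q hq fun h => hqr (Finset.mem_insert_of_mem h))
      (fun q hq r' hr' hqr => hle q hq r' hr' fun h => hqr (Finset.mem_insert_of_mem h)) (by
        have h3 : X \ (σ.retire r).resting = (X \ σ.resting).erase r := by
          ext q
          simp only [State.retire, Finset.mem_sdiff, Finset.mem_insert, Finset.mem_erase]
          tauto
        rw [h3, Finset.card_erase_of_mem hr]
        omega)
    refine Relation.ReflTransGen.head (Step.rest σ r hidle hQ (hnone r hrX hrr)) ?_
    have h4 : (σ.retire r).resting ∪ X = σ.resting ∪ X := by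
      simp only [State.retire]
      rw [Finset.insert_union, Finset.insert_eq_self]
      exact Finset.mem_union_right _ hrX
    rw [h4] at h2
    exact h2

/-- If every task is at least as fast on a GPU, then a CPU never has a candidate. -/
theorem not_candidate_inl (hI : ∀ j, I.gpuTime j ≤ I.cpuTime j) {σ : State I}
    (hσ : Consistent σ) {c : Fin I.m} (hc : Sum.inl c ∉ σ.resting) (j : I.Task)
    (r : I.Resource) (s : ℝ) : ¬ Candidate σ (Sum.inl c) j r s := by
  intro h
  have := h.time_lt hσ hc
  rcases r with c' | g
  · exact lt_irrefl _ this
  · exact absurd (hI j) (not_le.2 this)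

/-- The GPUs can take over CPU tasks that all complete at the same time `F` following any
timetable, provided that all tasks are at least as fast on a GPU. -/
theorem exists_spoliation_run (hI : ∀ j, I.gpuTime j ≤ I.cpuTime j) {F T : ℝ} {Z : Finset I.Task}
    {gpu : I.Task → Fin I.k} {start : I.Task → ℝ}
    (ht : Timetable gpu start (fun j => start j + I.gpuTime j) T Z)
    (hfin : ∀ j ∈ Z, start j + I.gpuTime j < F) (Q : Finset I.Task) (σ : State I)
    (hσ : Consistent σ) (hQ : σ.queue = [])
    (hfront : Front gpu start T Z Q fun g => σ.avail (Sum.inr g))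
    (hgpu : ∀ g, Sum.inr g ∉ σ.resting)
    (hcpu : ∀ c, Sum.inl c ∉ σ.resting → F ≤ σ.avail (Sum.inl c))
    (hle : ∀ i c u, σ.place i = some (Sum.inl c, u) → u + I.cpuTime i ≤ F)
    (hmem : ∀ j ∈ Q, ∃ c s, σ.place j = some (Sum.inl c, s) ∧ s + I.cpuTime j = F ∧
      Sum.inl c ∉ σ.resting)
    (hdone : ∀ j ∈ Z, j ∉ Q → ∃ g s, σ.place j = some (Sum.inr g, s)) :
    ∃ σ', Relation.ReflTransGen Step σ σ' ∧ Consistent σ' ∧ σ'.queue = [] ∧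
      (∀ j ∈ Z, ∃ g s, σ'.place j = some (Sum.inr g, s)) ∧ (∀ j, j ∉ Q → σ'.place j = σ.place j) ∧
      ∀ g, T ≤ σ'.avail (Sum.inr g) := by
  induction hn : Q.card generalizing Q σ with
  | zero =>
    obtain rfl := Finset.card_eq_zero.1 hn
    refine ⟨σ, Relation.ReflTransGen.refl, hσ, hQ, fun j hj => hdone j hj (by simp),
      fun j _ => rfl, fun g => (hfront.busy g).resolve_right ?_⟩
    rintro ⟨i, hi, -⟩
    simp at hi
  | succ n ih =>
    obtain ⟨j, hj, hmin⟩ := Q.exists_min_image start (Finset.card_pos.1 (by omega))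
    have hjZ := hfront.subset hj
    have heq : σ.avail (Sum.inr (gpu j)) = start j := hfront.avail_eq ht hj hmin
    have hge : ∀ g, start j ≤ σ.avail (Sum.inr g) := hfront.start_le_avail ht hj hmin
    obtain ⟨c, s, hjc, hsF, hc⟩ := hmem j hj
    have hjF := hfin j hjZ
    have hpos := I.gpuTime_pos j
    have hgeF : ∀ c', Sum.inl c' ∉ σ.resting → start j ≤ σ.avail (Sum.inl c') := fun c' hc' => by
      linarith [hcpu c' hc']
    have hidle : FirstIdle σ (Sum.inr (gpu j)) := by
      refine ⟨hgpu _, ?_⟩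
      rintro (c' | g) hr'
      · rw [heq]
        exact hgeF c' hr'
      · rw [heq]
        exact hge g
    have hcand : Candidate σ (Sum.inr (gpu j)) j (Sum.inl c) s := by
      refine ⟨hjc, by simp, ?_⟩
      simp only [Instance.time]
      rw [heq, hsF]
      exact hjF
    have hmax : ∀ i q u, Candidate σ (Sum.inr (gpu j)) i q u →
        u + I.time i q ≤ s + I.time j (Sum.inl c) := by
      intro i q u hi
      rcases q with c' | g
      · simp only [Instance.time]
        rw [hsF]
        exact hle i c' u hi.1
      · exact absurd (hi.time_lt hσ (hgpu _)) (lt_irrefl _)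
    have hstep₁ : Step σ (σ.takeOver (Sum.inr (gpu j)) j (Sum.inl c)) :=
      Step.spoliate σ _ j _ s hidle hQ hcand hmax
    have hσ₁ := hσ.step hstep₁
    -- the aborted CPU is idle now, and has no candidate
    have hidle₁ : FirstIdle (σ.takeOver (Sum.inr (gpu j)) j (Sum.inl c)) (Sum.inl c) := by
      refine ⟨hc, ?_⟩
      rintro (c' | g) hr'
      · by_cases hcc : c' = c
        · rw [hcc]
        · simpa [State.takeOver, hcc, heq] using hgeF c' hr'
      · by_cases hg : g = gpu j
        · subst hg
          simp only [State.takeOver, ne_eq, reduceCtorEq, not_false_eq_true,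
            Function.update_of_ne, Function.update_self, Instance.time]
          linarith
        · simpa [State.takeOver, hg, heq] using hge g
    have hstep₂ := Step.rest _ _ hidle₁ rfl
      fun i r u => not_candidate_inl hI hσ₁ hidle₁.1 i r u
    have hσ₂ := hσ₁.step hstep₂
    -- two tasks that complete at the same time are not on the same CPU
    have hcne : ∀ i c' u, i ≠ j → σ.place i = some (Sum.inl c', u) → u + I.cpuTime i = F →
        c' ≠ c := by
      rintro i c' u hij hi hu rfl
      have h1 := I.cpuTime_pos i
      have h2 := I.cpuTime_pos j
      rcases hσ.disjoint _ _ _ _ _ hij hi hjc with h | h <;> simp only [Instance.time] at h <;>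
        linarith
    obtain ⟨σ', h1, h2, h3, h4, h5, h6⟩ := ih (Q.erase j) _ hσ₂ rfl (by
        have h3 := hfront.erase ht hj hmin
        convert h3 using 1
        funext g
        by_cases hg : g = gpu j
        · subst hg
          simp [State.takeOver, heq, Instance.time]
        · simp [State.takeOver, hg])
      (fun g => by simpa [State.takeOver] using hgpu g)
      (fun c' hc' => by
        have hc'' : c' ≠ c ∧ Sum.inl c' ∉ σ.resting := by
          simpa [State.takeOver] using hc'
        simpa [State.takeOver, hc''.1] using hcpu c' hc''.2)
      (fun i c' u hi => by
        by_cases hij : i = j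
        · subst hij
          simp [State.takeOver] at hi
        · exact hle i c' u (by simpa [State.takeOver, hij] using hi))
      (fun i hi => by
        obtain ⟨hij, hi⟩ := Finset.mem_erase.1 hi
        obtain ⟨c', u, h1, h2, h3⟩ := hmem i hi
        exact ⟨c', u, by simpa [State.takeOver, hij] using h1, h2, by
          simpa [State.takeOver, hcne i c' u hij h1 h2] using h3⟩)
      (fun i hi hiQ => by
        by_cases hij : i = j
        · subst hij
          exact ⟨gpu i, σ.avail (Sum.inr (gpu i)), by simp [State.takeOver]⟩
        · obtain ⟨g, u, h1⟩ := hdone i hi fun h => hiQ (Finset.mem_erase.2 ⟨hij, h⟩)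
          exact ⟨g, u, by simpa [State.takeOver, hij] using h1⟩)
      (by rw [Finset.card_erase_of_mem hj]; omega)
    refine ⟨σ', Relation.ReflTransGen.head hstep₁ (Relation.ReflTransGen.head hstep₂ h1), h2, h3,
      h4, fun i hi => ?_, h6⟩
    have hij : i ≠ j := by
      rintro rfl
      exact hi hj
    rw [h5 i fun h => hi (Finset.mem_of_mem_erase h)]
    simp [State.takeOver, hij]

/-! ### A recipe for bad outputs -/

/-- A sorted list in which the tasks of the CPUs come first, in the order of their starting times
in `S`, followed by the tasks of the GPUs in the reverse order. -/
theorem exists_isSortedTaskList_of_schedule (S : Schedule I)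
    (hcross : ∀ i j, (S.proc i).isLeft = true → (S.proc j).isLeft = false → I.accel i ≤ I.accel j)
    (hcpu : ∀ i j, (S.proc i).isLeft = true → (S.proc j).isLeft = true → S.start i < S.start j →
      I.accel i ≤ I.accel j)
    (hgpu : ∀ i j, (S.proc i).isLeft = false → (S.proc j).isLeft = false → S.start i < S.start j →
      I.accel j ≤ I.accel i) :
    ∃ X Y : List I.Task, IsSortedTaskList (X ++ Y) ∧
      (∀ j ∈ X, (S.proc j).isLeft = true) ∧ (∀ j ∈ Y, (S.proc j).isLeft = false) ∧
      X.Pairwise (fun i j => S.start i ≤ S.start j) ∧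
      Y.Pairwise fun i j => S.start j ≤ S.start i := by
  classical
  -- lexicographic sorting, by `f` first and by acceleration factor next
  have key : ∀ (f : I.Task → ℝ) (b : Bool), ∃ X : List I.Task, X.Nodup ∧
      (∀ j, j ∈ X ↔ (S.proc j).isLeft = b) ∧
      X.Pairwise fun i j => f i < f j ∨ f i = f j ∧ I.accel i ≤ I.accel j := by
    intro f b
    let r : I.Task → I.Task → Prop := fun i j => f i < f j ∨ f i = f j ∧ I.accel i ≤ I.accel j
    have : DecidableRel r := Classical.decRel _
    have : Std.Total r := ⟨fun i j => by
      rcases lt_trichotomy (f i) (f j) with h | h | h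
      · exact Or.inl (Or.inl h)
      · exact (le_total (I.accel i) (I.accel j)).imp (fun h' => Or.inr ⟨h, h'⟩)
          fun h' => Or.inr ⟨h.symm, h'⟩
      · exact Or.inr (Or.inl h)⟩
    have : IsTrans I.Task r := ⟨by
      rintro i j k (h | ⟨h, h'⟩) (h1 | ⟨h1, h1'⟩)
      · exact Or.inl (h.trans h1)
      · exact Or.inl (h1 ▸ h)
      · exact Or.inl (h ▸ h1)
      · exact Or.inr ⟨h.trans h1, h'.trans h1'⟩⟩
    let l : List I.Task := (Finset.univ.filter fun j => (S.proc j).isLeft = b).toList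
    have hp := List.perm_insertionSort r l
    refine ⟨l.insertionSort r, hp.nodup_iff.2 (Finset.nodup_toList _), fun j => ?_,
      List.pairwise_insertionSort r l⟩
    rw [hp.mem_iff]
    simp [l]
  obtain ⟨X, hXn, hXm, hX⟩ := key S.start true
  obtain ⟨Y, hYn, hYm, hY⟩ := key (fun j => -S.start j) false
  refine ⟨X, Y, ⟨?_, fun j => ?_, ?_⟩, fun j hj => (hXm j).1 hj, fun j hj => (hYm j).1 hj,
    hX.imp fun h => ?_, hY.imp fun h => ?_⟩
  · refine List.nodup_append'.2 ⟨hXn, hYn, fun j hj hj' => ?_⟩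
    have h1 := (hXm j).1 hj
    rw [(hYm j).1 hj'] at h1
    exact absurd h1 (by simp)
  · rw [List.mem_append, hXm, hYm]
    cases (S.proc j).isLeft <;> simp
  · refine List.pairwise_append.2 ⟨hX.imp_of_mem fun {i j} hi hj h => ?_,
      hY.imp_of_mem fun {i j} hi hj h => ?_, fun i hi j hj =>
        hcross i j ((hXm i).1 hi) ((hYm j).1 hj)⟩
    · rcases h with h | h
      · exact hcpu i j ((hXm i).1 hi) ((hXm j).1 hj) h
      · exact h.2
    · rcases h with h | h
      · exact hgpu j i ((hYm j).1 hj) ((hYm i).1 hi) (neg_lt_neg_iff.1 h)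
      · exact h.2
  · rcases h with h | h
    · exact h.le
    · exact h.1.le
  · rcases h with h | h
    · exact (neg_lt_neg_iff.1 h).le
    · exact (neg_inj.1 h.1).ge

/-- The list phase follows `S`; it keeps the GPUs busy until `A`, and at
time `T` the CPUs start their last tasks, which complete at `F`. From `A` to `T'` the GPUs take
over those of `Z`, which leaves a task `z` that no GPU can improve any more. -/
theorem exists_output_le_makespan (hI : ∀ j, I.gpuTime j ≤ I.cpuTime j) (S : Schedule I)
    {T A T' F : ℝ} (hT : 0 < T) (hTF : T < F)
    (ht : Timetable S.proc S.start S.completion T Finset.univ)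
    (hnn : ∀ j, 0 ≤ S.start j) (hzero : ∀ r, ∃ j, S.proc j = r ∧ S.start j = 0)
    (hcross : ∀ i j, (S.proc i).isLeft = true → (S.proc j).isLeft = false → I.accel i ≤ I.accel j)
    (hcpu : ∀ i j, (S.proc i).isLeft = true → (S.proc j).isLeft = true → S.start i < S.start j →
      I.accel i ≤ I.accel j)
    (hgpu : ∀ i j, (S.proc i).isLeft = false → (S.proc j).isLeft = false → S.start i < S.start j →
      I.accel j ≤ I.accel i)
    (hA : ∀ g, ∃ j, S.proc j = Sum.inr g ∧ S.completion j = A)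
    (hA' : ∀ j, (S.proc j).isLeft = false → S.completion j ≤ A)
    (hF : ∀ j, (S.proc j).isLeft = true → S.completion j ≤ T ∨ S.completion j = F)
    {Z : Finset I.Task} {gpu : I.Task → Fin I.k} {start : I.Task → ℝ}
    (ht' : Timetable gpu start (fun j => start j + I.gpuTime j) T' Z)
    (hstart : ∀ j ∈ Z, A ≤ start j) (hbegin : ∀ g, ∃ j ∈ Z, gpu j = g ∧ start j = A)
    (hfin : ∀ j ∈ Z, start j + I.gpuTime j < F)
    (hZ : ∀ j ∈ Z, (S.proc j).isLeft = true ∧ S.completion j = F)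
    (hlate : ∀ j, j ∉ Z → (S.proc j).isLeft = true → S.completion j ≤ T' + I.gpuTime j)
    {z : I.Task} (hz : z ∉ Z) (hzF : S.completion z = F) :
    ∃ S', Output I S' ∧ F ≤ S'.makespan := by
  classical
  obtain ⟨X, Y, hL, hX, hY, hXs, hYs⟩ := exists_isSortedTaskList_of_schedule S hcross hcpu hgpu
  obtain ⟨σ₁, hrun₁, hQ₁, hrest₁, hplace₁, hTavail, havail₁⟩ :=
    exists_listPhase_run ht X Y (initial (X ++ Y)) rfl hL.1 hXs hYs hX hY
    { subset := Finset.subset_univ _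
      started := fun i _ hi => absurd (List.mem_toFinset.2 (hL.2.1 i)) hi
      avail_le := fun i _ => hnn i
      busy := fun r => by
        obtain ⟨j, h1, h2⟩ := hzero r
        exact Or.inr ⟨j, List.mem_toFinset.2 (hL.2.1 j), h1, h2⟩ }
    (fun j hj => absurd (hL.2.1 j) hj) rfl fun r => Or.inl rfl
  have hσ₁ := (consistent_initial hL).steps hrun₁
  have hcompl : ∀ j, S.completion j ≤ σ₁.avail (S.proc j) := fun j =>
    hσ₁.completion_le _ _ _ (hplace₁ j)
  have havail : ∀ r, ∃ j, S.proc j = r ∧ σ₁.avail r = S.completion j := fun r =>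
    (havail₁ r).resolve_left fun h => by linarith [hTavail r]
  have hgA : ∀ g, σ₁.avail (Sum.inr g) = A := by
    intro g
    obtain ⟨j, h1, h2⟩ := hA g
    obtain ⟨i, h3, h4⟩ := havail (Sum.inr g)
    refine le_antisymm ?_ ?_
    · rw [h4]
      exact hA' i (by simp [h3])
    · have := hcompl j
      rwa [h1, h2] at this
  -- the CPUs that are idle at time `T` have nothing to do
  let W : Finset I.Resource :=
    Finset.univ.filter fun r => r.isLeft = true ∧ σ₁.avail r ≤ T
  have hrun₂ := exists_rest_run σ₁ hQ₁ W
    (fun r hr hr' => by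
      obtain ⟨c, rfl⟩ := Sum.isLeft_iff.1 (Finset.mem_filter.1 hr).2.1
      exact not_candidate_inl hI hσ₁ hr')
    (fun r hr r' _ _ => (Finset.mem_filter.1 hr).2.2.trans (hTavail r'))
  rw [hrest₁, Finset.empty_union] at hrun₂
  obtain ⟨σ₃, hrun₃, hσ₃, hQ₃, hZ₃, hnZ₃, havail₃⟩ := exists_spoliation_run hI ht' hfin Z _
    (hσ₁.steps hrun₂) rfl
    { subset := Finset.Subset.refl _
      started := fun i hi hi' => absurd hi hi'
      avail_le := fun i hi => by
        simp only [hgA]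
        exact hstart i hi
      busy := fun g => Or.inr (by
        obtain ⟨j, h1, h2, h3⟩ := hbegin g
        exact ⟨j, h1, h2, h3.trans (hgA g).symm⟩) }
    (fun g => by simp [W])
    (fun c hc => by
      obtain ⟨j, h1, h2⟩ := havail (Sum.inl c)
      have h3 : T < σ₁.avail (Sum.inl c) := by simpa [W] using hc
      rw [h2] at h3
      rcases hF j (by simp [h1]) with h4 | h4
      · linarith
      · exact (h2.trans h4).ge)
    (fun i c u hi => by
      have h1 : S.proc i = Sum.inl c ∧ S.start i = u := by
        have := (hplace₁ i).symm.trans hi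
        simpa using this
      have h2 := hF i (by simp [h1.1])
      rw [Schedule.completion, h1.1, h1.2] at h2
      simp only [Instance.time] at h2
      rcases h2 with h2 | h2 <;> linarith)
    (fun j hj => by
      obtain ⟨c, hc⟩ := Sum.isLeft_iff.1 (hZ j hj).1
      have h1 := hplace₁ j
      have h2 := (hZ j hj).2
      have h3 := hcompl j
      rw [h2] at h3
      rw [Schedule.completion] at h2
      rw [hc] at h1 h2 h3
      refine ⟨c, S.start j, h1, h2, ?_⟩
      simp only [W, Finset.mem_filter, Finset.mem_univ, true_and, not_and, not_le]
      intro _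
      linarith)
    (fun j hj hj' => absurd hj hj')
  have hrun₄ := exists_rest_run σ₃ hQ₃ Finset.univ
    (fun r _ hr i q u hi => by
      rcases r with c | g
      · exact not_candidate_inl hI hσ₃ hr _ _ _ hi
      · have hlt := hi.time_lt hσ₃ hr
        rcases q with c | g'
        · have hiZ : i ∉ Z := fun h => by
            obtain ⟨g', s, h'⟩ := hZ₃ i h
            have := hi.1
            rw [h'] at this
            simp at this
          have h1 := hi.1
          rw [hnZ₃ i hiZ] at h1
          have h2 : S.proc i = Sum.inl c ∧ S.start i = u := by
            have := (hplace₁ i).symm.trans h1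
            simpa using this
          have h3 := hlate i hiZ (by simp [h2.1])
          have h4 := hi.2.2
          have h5 := havail₃ g
          rw [Schedule.completion, h2.1, h2.2] at h3
          simp only [Instance.time] at h3 h4
          linarith
        · exact lt_irrefl _ hlt)
    (fun r _ r' hr' => absurd (Finset.mem_univ r') hr')
  have hrun := (hrun₁.trans hrun₂).trans (hrun₃.trans hrun₄)
  have hσ := (consistent_initial hL).steps hrun
  choose f hf using hσ.exists_place (fun r => Finset.mem_union_right _ (Finset.mem_univ r))
  refine ⟨⟨fun j => (f j).1, fun j => (f j).2⟩, ⟨X ++ Y, _, hL, hrun,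
    fun r => Finset.mem_union_right _ (Finset.mem_univ r), hf⟩, ?_⟩
  have h1 : f z = (S.proc z, S.start z) := by
    have h2 := (hf z).symm.trans ((hnZ₃ z hz).trans (hplace₁ z))
    exact Option.some.inj h2
  refine le_trans ?_ (Schedule.completion_le_makespan _ z)
  rw [← hzF]
  simp only [Schedule.completion, h1, le_refl]

/-! ### A family of bad instances -/

namespace BadInstance

/-- The GPUs. -/
abbrev GPU (n : ℕ) : Type := Fin (n + 1) × Fin 6

/-- The CPUs. -/
abbrev CPU (n : ℕ) : Type := (GPU n × Fin 8) × Option (Fin (n + 1))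

/-- The tasks of the bad instance. The tasks `long`, `small` and `filler` occupy the resources
during the list phase. The tasks `first`, `second` and `final` are the ones that have to run on
GPUs; HeteroPrio starts them on CPUs, and the GPUs take over all but the last of them too late. -/
inductive Task (n : ℕ) : Type
  | long (x : GPU n × Fin 8) (b : Fin (n + 1))
  | small (x : GPU n × Fin 8) (b : Fin (n + 1))
  | filler (g : GPU n) (x : Fin 8)
  | first (i : Fin (n + 1)) (c : Fin 6)
  | second (i : Fin (n + 1)) (c : Fin 6)
  | final
deriving DecidableEq, Fintype

/-- The time of a `small` task; a `long` and a `small` task together take time `1`. -/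
noncomputable def δ (n : ℕ) : ℝ := 1 / (n + 2)

/-- The granularity of the GPU times of the tasks `first` and `second`. -/
noncomputable def ε (n : ℕ) : ℝ := 1 / (6 * (n + 1))

/-- The end of the list phase. -/
noncomputable def T (n : ℕ) : ℝ := (n + 1) * δ n

/-- The acceleration factor of a `filler`: the positive root of `r ^ 2 = 6 * r + 3`. -/
noncomputable def ρ : ℝ := 3 + 2 * Real.sqrt 3

/-- The CPU time of the tasks `first`, `second` and `final`. It is just small enough for their
acceleration factors not to exceed `ρ`, their GPU times being at least `1 / 3`. -/
noncomputable def P (n : ℕ) : ℝ := ρ / 3 - ε n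

/-- CPU times. -/
noncomputable def cpuTime (n : ℕ) : Task n → ℝ
  | .long _ _ => T n
  | .small _ _ => δ n
  | .filler _ x => if x = 7 then 1 else ρ * (T n / 7)
  | .first _ _ => P n
  | .second _ _ => P n
  | .final => P n

/-- GPU times. Note that `first i` and `second i` together take time `1 - ε`, whereas `second i` and
`first (i + 1)` together take time `1`. -/
noncomputable def gpuTime (n : ℕ) : Task n → ℝ
  | .long _ _ => T n
  | .small _ _ => δ n
  | .filler _ x => if x = 7 then ρ / 3 - 2 else T n / 7
  | .first i _ => 1 / 3 + i * ε n
  | .second i _ => 2 / 3 - (i + 1) * ε n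
  | .final => 1

theorem δ_pos (n : ℕ) : 0 < δ n := by unfold δ; positivity

theorem ε_pos (n : ℕ) : 0 < ε n := by unfold ε; positivity

theorem T_pos (n : ℕ) : 0 < T n := mul_pos (by positivity) (δ_pos n)

theorem T_add_δ (n : ℕ) : T n + δ n = 1 := by
  unfold T δ
  field_simp
  ring

theorem mul_ε (n : ℕ) : (n + 1) * ε n = 1 / 6 := by
  unfold ε
  field_simp

theorem ε_le (n : ℕ) : ε n ≤ 1 / 6 := by
  have h1 := mul_ε n
  have h2 := ε_pos n
  have h3 : (0 : ℝ) ≤ n := Nat.cast_nonneg n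
  nlinarith

theorem ρ_mul : ρ * (ρ / 3 - 2) = 1 := by
  have : Real.sqrt 3 ^ 2 = 3 := Real.sq_sqrt (by norm_num)
  unfold ρ
  nlinarith

theorem ρ_bounds : 6 < ρ ∧ ρ < 7 := by
  have h1 : 3 / 2 < Real.sqrt 3 := Real.lt_sqrt_of_sq_lt (by norm_num)
  have h2 : Real.sqrt 3 < 2 := (Real.sqrt_lt' (by norm_num)).2 (by norm_num)
  unfold ρ
  constructor <;> linarith

theorem cast_mul_ε_le {n : ℕ} (i : Fin (n + 1)) : ((i : ℕ) + 1) * ε n ≤ 1 / 6 := by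
  rw [← mul_ε n]
  have : ((i : ℕ) : ℝ) ≤ n := by exact_mod_cast Nat.lt_succ_iff.1 i.2
  exact mul_le_mul_of_nonneg_right (by linarith) (ε_pos n).le

theorem gpuTime_pos {n : ℕ} (t : Task n) : 0 < gpuTime n t := by
  have h1 := T_pos n
  have h2 := δ_pos n
  have h3 := ε_pos n
  have h4 := ρ_bounds
  cases t with
  | long => exact h1
  | small => exact h2
  | filler g x =>
    simp only [gpuTime]
    split_ifs <;> linarith
  | first i c => simp only [gpuTime]; positivity
  | second i c =>
    have := cast_mul_ε_le i
    simp only [gpuTime]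
    linarith
  | final => simp [gpuTime]

theorem gpuTime_le_cpuTime {n : ℕ} (t : Task n) : gpuTime n t ≤ cpuTime n t := by
  have h1 := T_pos n
  have h3 := ε_pos n
  have h3' := ε_le n
  have h4 := ρ_bounds
  cases t with
  | long => exact le_rfl
  | small => exact le_rfl
  | filler g x =>
    simp only [gpuTime, cpuTime]
    split_ifs
    · linarith
    · nlinarith
  | first i c =>
    have := cast_mul_ε_le i
    simp only [gpuTime, cpuTime, P]
    linarith
  | second i c =>
    have : 0 ≤ ((i : ℕ) + 1) * ε n := by positivity
    simp only [gpuTime, cpuTime, P]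
    linarith
  | final => simp only [gpuTime, cpuTime, P]; linarith

theorem cpuTime_pos {n : ℕ} (t : Task n) : 0 < cpuTime n t :=
  (gpuTime_pos t).trans_le (gpuTime_le_cpuTime t)

/-- The bad instance. -/
noncomputable def inst (n : ℕ) : Instance where
  n := Fintype.card (Task n)
  m := Fintype.card (CPU n)
  k := Fintype.card (GPU n)
  one_le_k := Fintype.card_pos
  k_le_m := Fintype.card_le_of_injective (fun g : GPU n => ((g, (0 : Fin 8)), none))
    fun g g' h => by simpa using h
  cpuTime j := cpuTime n ((Fintype.equivFin _).symm j)
  gpuTime j := gpuTime n ((Fintype.equivFin _).symm j)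
  cpuTime_pos _ := cpuTime_pos _
  gpuTime_pos _ := gpuTime_pos _

/-- The tasks of the instance. -/
noncomputable def task (n : ℕ) : Task n ≃ (inst n).Task := Fintype.equivFin _

/-- The resources of the instance. -/
noncomputable def res (n : ℕ) : CPU n ⊕ GPU n ≃ (inst n).Resource :=
  Equiv.sumCongr (Fintype.equivFin _) (Fintype.equivFin _)

/-- Processing times, before the tasks and resources are numbered. -/
noncomputable def time (n : ℕ) (t : Task n) : CPU n ⊕ GPU n → ℝ :=
  Sum.elim (fun _ => cpuTime n t) fun _ => gpuTime n t

theorem cpuTime_task {n : ℕ} (t : Task n) : (inst n).cpuTime (task n t) = cpuTime n t :=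
  congrArg (cpuTime n) (Equiv.symm_apply_apply _ t)

theorem gpuTime_task {n : ℕ} (t : Task n) : (inst n).gpuTime (task n t) = gpuTime n t :=
  congrArg (gpuTime n) (Equiv.symm_apply_apply _ t)

theorem time_task {n : ℕ} (t : Task n) (r : CPU n ⊕ GPU n) :
    (inst n).time (task n t) (res n r) = time n t r := by
  rcases r with c | g
  · exact cpuTime_task t
  · exact gpuTime_task t

theorem isLeft_res {n : ℕ} (r : CPU n ⊕ GPU n) : (res n r).isLeft = r.isLeft := by
  rcases r with c | g <;> rfl

/-- The schedule with given resources and starting times. -/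
noncomputable def sched {n : ℕ} (proc : Task n → CPU n ⊕ GPU n) (start : Task n → ℝ) :
    Schedule (inst n) where
  proc j := res n (proc ((task n).symm j))
  start j := start ((task n).symm j)

section sched

variable {n : ℕ} (proc : Task n → CPU n ⊕ GPU n) (start : Task n → ℝ) (t : Task n)

theorem proc_sched : (sched proc start).proc (task n t) = res n (proc t) := by simp [sched]

theorem start_sched : (sched proc start).start (task n t) = start t := by simp [sched]

theorem completion_sched :
    (sched proc start).completion (task n t) = start t + time n t (proc t) := by
  rw [Schedule.completion, proc_sched, start_sched, time_task]

end sched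

/-! ### A short schedule of the bad instance -/

/-- The resources in a schedule of makespan `1`. Most GPUs execute `second i` and `first (i + 1)`.
This leaves six GPUs for six tasks of length `1 / 3`, six of length `1 / 2` and one of length
`1`. -/
def optProc {n : ℕ} : Task n → CPU n ⊕ GPU n
  | .long x b => Sum.inl (x, some b)
  | .small x b => Sum.inl (x, some b)
  | .filler g x => Sum.inl ((g, x), none)
  | .first i c => Sum.inr (if i = 0 then (0, ⟨c / 3, by omega⟩) else (i, c))
  | .second i c =>
    Sum.inr (if h : i + 1 < n + 1 then (⟨i + 1, h⟩, c) else (0, ⟨2 + c / 2, by omega⟩))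
  | .final => Sum.inr (0, 5)

/-- The starting times of the short schedule. -/
noncomputable def optStart {n : ℕ} : Task n → ℝ
  | .long _ _ => 0
  | .small _ _ => T n
  | .filler _ _ => 0
  | .first i c => if i = 0 then ((c % 3 : ℕ) : ℝ) / 3 else 0
  | .second i c => if (i : ℕ) + 1 < n + 1 then 1 / 3 + (i + 1) * ε n else ((c % 2 : ℕ) : ℝ) / 2
  | .final => 0

theorem sched_feasible {n : ℕ} {proc : Task n → CPU n ⊕ GPU n} {start : Task n → ℝ}
    (h0 : ∀ t, 0 ≤ start t)
    (hd : ∀ s t, s ≠ t → proc s = proc t →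
      start s + time n s (proc s) ≤ start t ∨ start t + time n t (proc t) ≤ start s) :
    (sched proc start).Feasible := by
  refine ⟨fun j => h0 _, fun i j hij hp => ?_⟩
  obtain ⟨s, rfl⟩ := (task n).surjective i
  obtain ⟨t, rfl⟩ := (task n).surjective j
  rw [proc_sched, proc_sched] at hp
  rw [completion_sched, completion_sched, start_sched, start_sched]
  exact hd s t (fun h => hij (h ▸ rfl)) ((res n).injective hp)

theorem add_div_le {a b : ℕ} {d : ℝ} (hd : 0 < d) (h : a < b) :
    (a : ℝ) / d + 1 / d ≤ (b : ℝ) / d := by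
  rw [← add_div]
  exact div_le_div_of_nonneg_right (by exact_mod_cast h) hd.le

theorem second_time_eq_half {n : ℕ} (i : Fin (n + 1)) (hi : ¬ (i : ℕ) + 1 < n + 1) :
    2 / 3 - ((i : ℕ) + 1) * ε n = 1 / 2 := by
  have h1 := mul_ε n
  have h2 : (i : ℕ) = n := by omega
  rw [h2]
  linarith

/-- By symmetry, only pairs of tasks in the order of the constructors need to be examined. -/
theorem optStart_disjoint {n : ℕ} (s t : Task n) (hst : s ≠ t)
    (hp : (optProc s : CPU n ⊕ GPU n) = optProc t) (hle : s.ctorIdx ≤ t.ctorIdx) :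
    optStart s + time n s (optProc s) ≤ optStart t ∨
      optStart t + time n t (optProc t) ≤ optStart s := by
  rcases s with ⟨x, b⟩ | ⟨x, b⟩ | ⟨g, x⟩ | ⟨i, c⟩ | ⟨i, c⟩ | _ <;>
    rcases t with ⟨x', b'⟩ | ⟨x', b'⟩ | ⟨g', x'⟩ | ⟨i', c'⟩ | ⟨i', c'⟩ | _ <;>
    simp only [optProc, Sum.inl.injEq, Sum.inr.injEq, Prod.mk.injEq, Option.some.injEq,
      reduceCtorEq, and_false, and_true] at hp <;>
    simp only [ne_eq, Task.long.injEq, Task.small.injEq, Task.filler.injEq, Task.first.injEq,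
      Task.second.injEq, not_true_eq_false] at hst <;>
    simp [Task.ctorIdx] at hle <;>
    simp only [optProc, optStart, time, Sum.elim_inl, Sum.elim_inr, cpuTime, gpuTime]
  · exact absurd hp hst
  · left; linarith
  · exact absurd hp hst
  · exact absurd hp hst
  · split_ifs at hp ⊢ with hi hi' hi' <;>
      simp only [Prod.mk.injEq, Fin.mk.injEq, true_and] at hp
    · subst hi hi'
      simp only [true_and, Fin.ext_iff] at hst
      simp only [Fin.val_zero, Nat.cast_zero, zero_mul, add_zero]
      rcases Nat.lt_or_ge ((c : ℕ) % 3) ((c' : ℕ) % 3) with h | h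
      · exact Or.inl (add_div_le (by norm_num) h)
      · exact Or.inr (add_div_le (by norm_num) (by omega))
    · exact absurd hp.1.symm hi'
    · exact absurd hp.1 hi
    · exact absurd hp hst
  · split_ifs at hp ⊢ with hi hi' hi' <;>
      simp only [Prod.mk.injEq, Fin.ext_iff, Fin.val_zero] at hp
    · omega
    · omega
    · left
      rw [hp.1]
      push_cast
      linarith
    · exact absurd (Fin.ext hp.1) hi
  · split_ifs at hp ⊢ with hi <;> simp only [Prod.mk.injEq, Fin.ext_iff, true_and] at hp
    · have : ((5 : Fin 6) : ℕ) = 5 := rfl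
      omega
    · exact absurd (Fin.ext hp.1) hi
  · split_ifs at hp ⊢ with hi hi' hi' <;>
      simp only [Prod.mk.injEq, Fin.ext_iff, Fin.val_zero] at hp
    · exact absurd ⟨Fin.ext (by omega), Fin.ext hp.2⟩ hst
    · omega
    · omega
    · have hii : i = i' := Fin.ext (by omega)
      rw [second_time_eq_half i hi, second_time_eq_half i' hi']
      simp only [hii, true_and, Fin.ext_iff] at hst
      rcases Nat.lt_or_ge ((c : ℕ) % 2) ((c' : ℕ) % 2) with h | h
      · exact Or.inl (add_div_le (by norm_num) h)
      · exact Or.inr (add_div_le (by norm_num) (by omega))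
  · split_ifs at hp ⊢ with hi <;> simp only [Prod.mk.injEq, Fin.ext_iff, Fin.val_zero] at hp
    · omega
    · have : ((5 : Fin 6) : ℕ) = 5 := rfl
      omega

theorem optMakespan_le_one (n : ℕ) : (inst n).optMakespan ≤ 1 := by
  have hT := T_pos n
  have hε := ε_pos n
  have hδ := δ_pos n
  have hTδ := T_add_δ n
  have hfeas : (sched (optProc (n := n)) optStart).Feasible := by
    refine sched_feasible (fun t => ?_) fun s t hst hp => ?_
    · rcases t with ⟨x, b⟩ | ⟨x, b⟩ | ⟨g, x⟩ | ⟨i, c⟩ | ⟨i, c⟩ | _ <;> simp only [optStart] <;>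
        (try split_ifs) <;> positivity
    · rcases le_total s.ctorIdx t.ctorIdx with h | h
      · exact optStart_disjoint s t hst hp h
      · exact (optStart_disjoint t s hst.symm hp.symm h).symm
  have hbdd : BddBelow {C : ℝ | ∃ S : Schedule (inst n), S.Feasible ∧ S.makespan = C} := by
    refine ⟨0, ?_⟩
    rintro C ⟨S, hS, rfl⟩
    exact hS.makespan_nonneg
  refine (csInf_le hbdd ⟨_, hfeas, rfl⟩).trans (Real.iSup_le (fun j => ?_) zero_le_one)
  obtain ⟨t, rfl⟩ := (task n).surjective j
  rw [completion_sched]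
  rcases t with ⟨x, b⟩ | ⟨x, b⟩ | ⟨g, x⟩ | ⟨i, c⟩ | ⟨i, c⟩ | _ <;>
    simp only [optProc, optStart, time, Sum.elim_inl, Sum.elim_inr, cpuTime, gpuTime]
  · linarith
  · linarith
  · have := ρ_bounds
    split_ifs
    · norm_num
    · nlinarith
  · have := cast_mul_ε_le i
    split_ifs with hi
    · have h3 : ((c % 3 : ℕ) : ℝ) ≤ 2 := by
        exact_mod_cast Nat.lt_succ_iff.1 (Nat.mod_lt c (by norm_num))
      rw [hi]
      simp only [Fin.val_zero, Nat.cast_zero, zero_mul]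
      linarith
    · linarith
  · split_ifs with hi
    · linarith
    · rw [second_time_eq_half i hi]
      have h3 : ((c % 2 : ℕ) : ℝ) ≤ 1 := by
        exact_mod_cast Nat.lt_succ_iff.1 (Nat.mod_lt c (by norm_num))
      linarith
  · norm_num

/-! ### A long output on the bad instance -/

/-- The resources on which HeteroPrio starts the tasks of the list. -/
def listProc {n : ℕ} : Task n → CPU n ⊕ GPU n
  | .long x b => Sum.inl (x, some b)
  | .small x _ => Sum.inl (x, none)
  | .filler g _ => Sum.inr g
  | .first i c => Sum.inl (((i, c), 0), none)
  | .second i c => Sum.inl (((i, c), 1), none)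
  | .final => Sum.inl (((0, 0), 2), none)

/-- The times at which HeteroPrio starts the tasks of the list. -/
noncomputable def listStart {n : ℕ} : Task n → ℝ
  | .long _ _ => 0
  | .small _ b => b * δ n
  | .filler _ x => x * (T n / 7)
  | .first _ _ => T n
  | .second _ _ => T n
  | .final => T n

/-- The time at which the GPUs begin to take tasks over. -/
noncomputable def A (n : ℕ) : ℝ := T n + (ρ / 3 - 2)

/-- The GPUs to which tasks are moved by spoliation (the values at other tasks are irrelevant). -/
def moveProc {n : ℕ} : Task n → GPU n
  | .first i c => (i, c)
  | .second i c => (i, c)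
  | _ => (0, 0)

/-- The times at which tasks are moved by spoliation (the values at other tasks are
irrelevant). -/
noncomputable def moveStart {n : ℕ} : Task n → ℝ
  | .first _ _ => A n
  | .second i _ => A n + (1 / 3 + i * ε n)
  | _ => 0

/-- The tasks that are moved by spoliation. -/
def moved (n : ℕ) : Finset (Task n) :=
  Finset.univ.filter fun t => ∃ i c, t = .first i c ∨ t = .second i c

theorem forall_mem_moved {n : ℕ} {p : Task n → Prop} :
    (∀ t ∈ moved n, p t) ↔ (∀ i c, p (.first i c)) ∧ ∀ i c, p (.second i c) := by
  simp only [moved, Finset.mem_filter, Finset.mem_univ, true_and]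
  constructor
  · exact fun h => ⟨fun i c => h _ ⟨i, c, Or.inl rfl⟩, fun i c => h _ ⟨i, c, Or.inr rfl⟩⟩
  · rintro ⟨h1, h2⟩ t ⟨i, c, rfl | rfl⟩
    · exact h1 i c
    · exact h2 i c

theorem T_eq (n : ℕ) : T n = (n + 1) * δ n := rfl

theorem succ_mul_δ_le {n : ℕ} {a b : ℕ} (h : a < b) : (a : ℝ) * δ n + δ n ≤ b * δ n := by
  have h1 : (a : ℝ) + 1 ≤ b := by exact_mod_cast h
  have := mul_le_mul_of_nonneg_right h1 (δ_pos n).le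
  linarith

theorem succ_mul_δ_le_T {n : ℕ} (b : Fin (n + 1)) : ((b : ℕ) : ℝ) * δ n + δ n ≤ T n := by
  have := succ_mul_δ_le (n := n) b.2
  rw [T_eq]
  push_cast at this
  exact this

theorem filler_completion_le {n : ℕ} (x x' : Fin 8) (h : (x : ℕ) < x') :
    ((x : ℕ) : ℝ) * (T n / 7) + (if x = 7 then ρ / 3 - 2 else T n / 7) ≤
      ((x' : ℕ) : ℝ) * (T n / 7) := by
  have h7 : ((7 : Fin 8) : ℕ) = 7 := rfl
  rw [if_neg (by rintro rfl; omega)]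
  have h1 : ((x : ℕ) : ℝ) + 1 ≤ (x' : ℕ) := by exact_mod_cast h
  have := mul_le_mul_of_nonneg_right h1 (show 0 ≤ T n / 7 by linarith [T_pos n])
  linarith

theorem listStart_disjoint {n : ℕ} (s t : Task n) (hst : s ≠ t)
    (hp : (listProc s : CPU n ⊕ GPU n) = listProc t) (hle : s.ctorIdx ≤ t.ctorIdx) :
    listStart s + time n s (listProc s) ≤ listStart t ∨
      listStart t + time n t (listProc t) ≤ listStart s := by
  rcases s with ⟨x, b⟩ | ⟨x, b⟩ | ⟨g, x⟩ | ⟨i, c⟩ | ⟨i, c⟩ | _ <;>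
    rcases t with ⟨x', b'⟩ | ⟨x', b'⟩ | ⟨g', x'⟩ | ⟨i', c'⟩ | ⟨i', c'⟩ | _ <;>
    simp only [listProc, Sum.inl.injEq, Sum.inr.injEq, Prod.mk.injEq, Option.some.injEq,
      reduceCtorEq, and_false, and_true] at hp <;>
    simp only [ne_eq, Task.long.injEq, Task.small.injEq, Task.filler.injEq, Task.first.injEq,
      Task.second.injEq, not_true_eq_false] at hst <;>
    simp [Task.ctorIdx] at hle <;>
    simp only [listProc, listStart, time, Sum.elim_inl, Sum.elim_inr, cpuTime, gpuTime]
  · exact absurd hp hst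
  · simp only [hp, true_and, Fin.ext_iff] at hst
    rcases Nat.lt_or_ge (b : ℕ) b' with h | h
    · exact Or.inl (succ_mul_δ_le h)
    · exact Or.inr (succ_mul_δ_le (by omega))
  · exact Or.inl (succ_mul_δ_le_T b)
  · exact Or.inl (succ_mul_δ_le_T b)
  · exact Or.inl (succ_mul_δ_le_T b)
  · simp only [hp, true_and, Fin.ext_iff] at hst
    rcases Nat.lt_or_ge (x : ℕ) x' with h | h
    · exact Or.inl (filler_completion_le x x' h)
    · exact Or.inr (filler_completion_le x' x (by omega))
  · exact absurd hp hst
  · exact absurd hp.2 (by decide)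
  · exact absurd hp.2 (by decide)
  · exact absurd hp hst
  · exact absurd hp.2 (by decide)

theorem listTimetable (n : ℕ) :
    Timetable (listProc (n := n)) listStart (fun t => listStart t + time n t (listProc t)) (T n)
      Finset.univ where
  start_lt t _ := by
    have : 0 < time n t (listProc t) := by
      rcases listProc t with c | g
      · exact cpuTime_pos t
      · exact gpuTime_pos t
    linarith
  start_le t _ := by
    have hT := T_pos n
    rcases t with ⟨x, b⟩ | ⟨x, b⟩ | ⟨g, x⟩ | ⟨i, c⟩ | ⟨i, c⟩ | _ <;>
      simp only [listStart, le_refl]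
    · exact hT.le
    · linarith [succ_mul_δ_le_T b, δ_pos n]
    · have : ((x : ℕ) : ℝ) ≤ 7 := by exact_mod_cast Nat.lt_succ_iff.1 x.2
      nlinarith
  disjoint s _ t _ hst hp := by
    rcases le_total s.ctorIdx t.ctorIdx with h | h
    · exact listStart_disjoint s t hst hp h
    · exact (listStart_disjoint t s hst.symm hp.symm h).symm
  next t _ := by
    have hT := T_pos n
    have hP : 0 < P n := cpuTime_pos (Task.final (n := n))
    rcases t with ⟨x, b⟩ | ⟨x, b⟩ | ⟨g, x⟩ | ⟨i, c⟩ | ⟨i, c⟩ | _ <;>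
      simp only [listProc, listStart, time, Sum.elim_inl, Sum.elim_inr, cpuTime, gpuTime]
    · left; linarith
    · by_cases hb : (b : ℕ) + 1 < n + 1
      · refine Or.inr ⟨.small x ⟨b + 1, hb⟩, Finset.mem_univ _, rfl, ?_⟩
        push_cast
        ring
      · left
        have h1 : (b : ℕ) = n := by omega
        rw [h1, T_eq]
        linarith
    · by_cases hx : x = 7
      · left
        have := ρ_bounds
        subst hx
        rw [if_pos rfl, show ((7 : Fin 8) : ℕ) = 7 from rfl]
        push_cast
        linarith
      · have h7 : ((7 : Fin 8) : ℕ) = 7 := rfl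
        have hx' : (x : ℕ) + 1 < 8 := by
          have h1 : (x : ℕ) ≠ 7 := fun h => hx (Fin.ext h)
          omega
        refine Or.inr ⟨.filler g ⟨x + 1, hx'⟩, Finset.mem_univ _, rfl, ?_⟩
        rw [if_neg hx]
        push_cast
        ring
    · left; linarith
    · left; linarith
    · left; linarith

theorem moveTimetable (n : ℕ) :
    Timetable (moveProc (n := n)) moveStart (fun t => moveStart t + gpuTime n t)
      (A n + (1 - ε n)) (moved n) where
  start_lt t _ := by linarith [gpuTime_pos t]
  start_le := by
    have h1 := ε_le n
    refine forall_mem_moved.2 ⟨fun i c => ?_, fun i c => ?_⟩ <;> simp only [moveStart]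
    · linarith
    · linarith [cast_mul_ε_le i, ε_pos n]
  disjoint := by
    refine forall_mem_moved.2 ⟨fun i c => forall_mem_moved.2 ⟨fun i' c' hne hp => ?_,
      fun i' c' hne hp => ?_⟩, fun i c => forall_mem_moved.2 ⟨fun i' c' hne hp => ?_,
      fun i' c' hne hp => ?_⟩⟩ <;> simp only [moveProc, Prod.mk.injEq] at hp <;>
      obtain ⟨rfl, rfl⟩ := hp <;> simp only [moveStart, gpuTime]
    · exact absurd rfl hne
    · exact Or.inl le_rfl
    · exact Or.inr le_rfl
    · exact absurd rfl hne
  next := by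
    refine forall_mem_moved.2 ⟨fun i c => Or.inr ⟨.second i c, ?_, rfl, ?_⟩, fun i c => Or.inl ?_⟩
    · simp [moved]
    · simp only [moveStart, gpuTime]
    · simp only [moveStart, gpuTime]
      linarith

theorem accel_task {n : ℕ} (t : Task n) :
    (inst n).accel (task n t) = cpuTime n t / gpuTime n t := by
  rw [Instance.accel, cpuTime_task, gpuTime_task]

theorem one_le_accel {n : ℕ} (t : Task n) : 1 ≤ cpuTime n t / gpuTime n t :=
  (one_le_div (gpuTime_pos t)).2 (gpuTime_le_cpuTime t)

theorem accel_filler {n : ℕ} (g : GPU n) (x : Fin 8) :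
    cpuTime n (.filler g x) / gpuTime n (.filler g x) = ρ := by
  rw [div_eq_iff (gpuTime_pos _).ne']
  simp only [cpuTime, gpuTime]
  split_ifs
  · exact ρ_mul.symm
  · rfl

theorem accel_le {n : ℕ} (t : Task n) : cpuTime n t / gpuTime n t ≤ ρ := by
  have h1 := ρ_bounds
  have h2 := ε_pos n
  rcases t with ⟨x, b⟩ | ⟨x, b⟩ | ⟨g, x⟩ | ⟨i, c⟩ | ⟨i, c⟩ | _
  · rw [cpuTime, gpuTime, div_self (T_pos n).ne']
    linarith
  · rw [cpuTime, gpuTime, div_self (δ_pos n).ne']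
    linarith
  · rw [accel_filler]
  · rw [div_le_iff₀ (gpuTime_pos _)]
    simp only [cpuTime, gpuTime, P]
    have : 0 ≤ ρ * ((i : ℕ) * ε n) := mul_nonneg (by linarith) (by positivity)
    linarith
  · rw [div_le_iff₀ (gpuTime_pos _)]
    simp only [cpuTime, gpuTime, P]
    have := mul_le_mul_of_nonneg_left (cast_mul_ε_le i) (show 0 ≤ ρ by linarith)
    linarith
  · simp only [cpuTime, gpuTime, P]
    linarith

theorem exists_output_ge (n : ℕ) :
    ∃ S, Output (inst n) S ∧ T n + P n ≤ S.makespan := by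
  have hT := T_pos n
  have hε := ε_pos n
  have hε' := ε_le n
  have hρ := ρ_bounds
  have hforall : ∀ {p : (inst n).Task → Prop}, (∀ t, p (task n t)) → ∀ j, p j := fun h j => by
    obtain ⟨t, rfl⟩ := (task n).surjective j
    exact h t
  have hmoved : ∀ {p : (inst n).Task → Prop}, (∀ t ∈ moved n, p (task n t)) →
      ∀ j ∈ (moved n).map (task n).toEmbedding, p j := fun h j hj => by
    obtain ⟨t, ht, rfl⟩ := Finset.mem_map.1 hj
    exact h t ht
  refine exists_output_le_makespan (T := T n) (A := A n) (T' := A n + (1 - ε n)) (F := T n + P n)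
    (Z := (moved n).map (task n).toEmbedding)
    (gpu := fun j => Fintype.equivFin (GPU n) (moveProc ((task n).symm j)))
    (start := fun j => moveStart ((task n).symm j)) (z := task n .final)
    (hforall fun t => ?_) (sched listProc listStart) hT ?_ ?_ (hforall fun t => ?_) (fun r => ?_)
    (hforall fun s => hforall fun t hs ht => ?_) (hforall fun s => hforall fun t hs ht hlt => ?_)
    (hforall fun s => hforall fun t hs ht hlt => ?_) (fun g => ?_) (hforall fun t ht => ?_)
    (hforall fun t ht => ?_) ?_ ?_ (fun g => ?_) ?_ ?_ (hforall fun t ht ht' => ?_) ?_ ?_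
  · rw [cpuTime_task, gpuTime_task]
    exact gpuTime_le_cpuTime t
  · unfold P
    linarith
  · have h := (listTimetable n).transport (task n) (res n).injective
    rw [Finset.map_univ_equiv] at h
    have hc : (sched listProc listStart).completion = fun j => listStart ((task n).symm j) +
        time n ((task n).symm j) (listProc ((task n).symm j)) := by
      funext j
      obtain ⟨t, rfl⟩ := (task n).surjective j
      rw [completion_sched, Equiv.symm_apply_apply]
    rw [hc]
    exact h
  · rw [start_sched]
    have := δ_pos n
    cases t <;> simp only [listStart] <;> positivity
  · obtain ⟨r, rfl⟩ := (res n).surjective r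
    rcases r with ⟨x, _ | b⟩ | g
    · exact ⟨task n (.small x 0), by rw [proc_sched]; rfl, by simp [start_sched, listStart]⟩
    · exact ⟨task n (.long x b), by rw [proc_sched]; rfl, by simp [start_sched, listStart]⟩
    · exact ⟨task n (.filler g 0), by rw [proc_sched]; rfl, by simp [start_sched, listStart]⟩
  · rw [proc_sched, isLeft_res] at ht
    rw [accel_task, accel_task]
    cases t <;> simp [listProc] at ht
    rw [accel_filler]
    exact accel_le s
  · rw [proc_sched, isLeft_res] at hs ht
    rw [start_sched, start_sched] at hlt
    rw [accel_task, accel_task]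
    have hle := (listTimetable n).start_le t (Finset.mem_univ t)
    cases s <;> simp only [listStart, listProc, Sum.isLeft_inr, Bool.false_eq_true] at hlt hs
    · rw [cpuTime, gpuTime, div_self hT.ne']
      exact one_le_accel t
    · rw [cpuTime, gpuTime, div_self (δ_pos n).ne']
      exact one_le_accel t
    -- the remaining tasks start at `T`, after which nothing starts
    all_goals exact absurd hlt (not_lt.2 hle)
  · rw [proc_sched, isLeft_res] at hs ht
    rw [accel_task, accel_task]
    cases s <;> simp [listProc] at hs
    rw [accel_filler]
    exact accel_le t
  · obtain ⟨g, rfl⟩ := (Fintype.equivFin (GPU n)).surjective g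
    refine ⟨task n (.filler g 7), by rw [proc_sched]; rfl, ?_⟩
    rw [completion_sched]
    simp only [listStart, listProc, time, Sum.elim_inr, gpuTime, if_true, A]
    rw [show ((7 : Fin 8) : ℕ) = 7 from rfl]
    push_cast
    ring
  · rw [proc_sched, isLeft_res] at ht
    rw [completion_sched]
    cases t <;> simp [listProc] at ht
    rename_i g x
    simp only [listStart, listProc, time, Sum.elim_inr, gpuTime, A]
    have h7 : ((7 : Fin 8) : ℕ) = 7 := rfl
    split_ifs with hx
    · rw [hx, h7]
      push_cast
      linarith
    · have h1 : ((x : ℕ) : ℝ) + 1 ≤ 7 := by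
        have h2 : (x : ℕ) ≠ 7 := fun h => hx (Fin.ext h)
        have h3 : (x : ℕ) + 1 ≤ 7 := by omega
        exact_mod_cast h3
      nlinarith
  · rw [proc_sched, isLeft_res] at ht
    rw [completion_sched]
    cases t <;> simp [listProc] at ht <;>
      simp only [listStart, listProc, time, Sum.elim_inl, cpuTime]
    · left; linarith
    · left; exact succ_mul_δ_le_T _
    all_goals right; trivial
  · exact (moveTimetable n).transport (task n) (Fintype.equivFin (GPU n)).injective
  · refine hmoved (forall_mem_moved.2 ⟨fun i c => ?_, fun i c => ?_⟩) <;>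
      simp only [Equiv.symm_apply_apply, moveStart]
    · exact le_rfl
    · have : 0 ≤ ((i : ℕ) : ℝ) * ε n := by positivity
      linarith
  · obtain ⟨⟨i, c⟩, rfl⟩ := (Fintype.equivFin (GPU n)).surjective g
    refine ⟨task n (.first i c), ?_, ?_, ?_⟩
    · simp [moved]
    · simp only [Equiv.symm_apply_apply, moveProc]
      rfl
    · simp [moveStart]
  · refine hmoved (forall_mem_moved.2 ⟨fun i c => ?_, fun i c => ?_⟩) <;>
      rw [gpuTime_task] <;> simp only [Equiv.symm_apply_apply, moveStart, gpuTime, A, P]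
    · linarith [cast_mul_ε_le i]
    · linarith
  · refine hmoved (forall_mem_moved.2 ⟨fun i c => ?_, fun i c => ?_⟩) <;>
      rw [proc_sched, isLeft_res, completion_sched] <;> exact ⟨rfl, rfl⟩
  · rw [proc_sched, isLeft_res] at ht'
    rw [completion_sched, gpuTime_task]
    have hpos := gpuTime_pos t
    cases t <;> simp [listProc] at ht' <;> simp [moved] at ht <;>
      simp only [listStart, listProc, time, Sum.elim_inl, cpuTime, A] at hpos ⊢
    · linarith
    · linarith [succ_mul_δ_le_T (n := n) ‹Fin (n + 1)›]
    · simp only [P, gpuTime]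
      linarith
  · simp [moved]
  · rw [completion_sched]
    rfl

theorem le_approximationRatio (n : ℕ) :
    ((T n + P n : ℝ) : EReal) ≤ approximationRatio Output := by
  obtain ⟨S, hS, hle⟩ := exists_output_ge n
  refine le_trans ?_ (le_iSup_of_le (inst n) (le_iSup_of_le S (le_iSup_of_le hS le_rfl)))
  rw [EReal.coe_le_coe_iff]
  have hP : 0 < P n := cpuTime_pos (Task.final (n := n))
  have hpos : 0 < S.makespan := by linarith [T_pos n]
  -- the optimal makespan is positive, so the quotient means what it should
  have hopt : 0 < (inst n).optMakespan := by
    have h1 := hS.makespan_le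
    have h2 : 0 < 2 + Real.sqrt 2 := by positivity
    by_contra! h3
    nlinarith
  rw [le_div_iff₀ hopt]
  have h4 := mul_le_mul_of_nonneg_left (optMakespan_le_one n) (show 0 ≤ T n + P n by
    linarith [T_pos n])
  linarith

theorem tendsto_lower_bound :
    Filter.Tendsto (fun n => T n + P n) Filter.atTop (nhds (2 + 2 / Real.sqrt 3)) := by
  have h1 : Filter.Tendsto (fun n : ℕ => 1 / ((n : ℝ) + 1)) Filter.atTop (nhds 0) :=
    tendsto_one_div_add_atTop_nhds_zero_nat
  have hδ : Filter.Tendsto δ Filter.atTop (nhds 0) := by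
    have := (Filter.tendsto_add_atTop_iff_nat 1).2 h1
    refine this.congr fun n => ?_
    unfold δ
    push_cast
    ring
  have hε : Filter.Tendsto ε Filter.atTop (nhds 0) := by
    have := h1.const_mul (1 / 6)
    rw [mul_zero] at this
    refine this.congr fun n => ?_
    unfold ε
    field_simp
  have heq : (2 + 2 / Real.sqrt 3 : ℝ) = 1 - 0 + (ρ / 3 - 0) := by
    have h3 : Real.sqrt 3 ^ 2 = 3 := Real.sq_sqrt (by norm_num)
    have h3' : 0 < Real.sqrt 3 := Real.sqrt_pos.2 (by norm_num)
    unfold ρ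
    field_simp
    nlinarith
  rw [heq]
  refine Filter.Tendsto.congr (fun n => ?_) (((hδ.const_sub 1)).add (hε.const_sub (ρ / 3)))
  rw [P, ← T_add_δ n]
  ring

end BadInstance

theorem le_approximationRatio :
    ((2 + 2 / Real.sqrt 3 : ℝ) : EReal) ≤ approximationRatio Output :=
  le_of_tendsto' (EReal.tendsto_coe.2 BadInstance.tendsto_lower_bound)
    BadInstance.le_approximationRatio

end HeteroPrio

end HybridScheduling

theorem mainTheorem1 :
    -- HeteroPrio always has an output, and its outputs are feasible schedules
    (∀ I : HybridScheduling.Instance,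
      (∃ S, HybridScheduling.HeteroPrio.Output I S) ∧
        ∀ S, HybridScheduling.HeteroPrio.Output I S → S.Feasible) ∧
    -- the general approximation ratio
    ((2 + 2 / Real.sqrt 3 : ℝ) : EReal) ≤
      HybridScheduling.approximationRatio HybridScheduling.HeteroPrio.Output ∧
    HybridScheduling.approximationRatio HybridScheduling.HeteroPrio.Output ≤
      ((2 + Real.sqrt 2 : ℝ) : EReal) ∧
    -- the special case
    (∀ I : HybridScheduling.Instance,
      (∀ j, I.cpuTime j ≤ I.optMakespan ∧ I.gpuTime j ≤ I.optMakespan) →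
        ∀ S, HybridScheduling.HeteroPrio.Output I S → S.makespan ≤ 2 * I.optMakespan) :=
  ⟨fun I => ⟨HybridScheduling.HeteroPrio.exists_output I, fun _ hS => hS.feasible⟩,
    HybridScheduling.HeteroPrio.le_approximationRatio,
    HybridScheduling.HeteroPrio.approximationRatio_le, fun _ h _ hS => hS.makespan_le_two_mul h⟩
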